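/- Let $d\ge 0$ be an integer and let $\alpha,\beta\in\mathbb R^d$ satisfy $\alpha_i,\beta_i>-\tfrac12$ for all $i$. Let $\mu$ be the normalized Jacobi probability measure on $[-1,1]^d$, $$\mu(dx)=\prod_{i=1}^d \frac{(1-x_i)^{\alpha_i}(1+x_i)^{\beta_i}}{2^{\alpha_i+\beta_i+1}B(\alpha_i+1,\beta_i+1)}\,dx_i ,$$ let $p_\kappa$, $\kappa\in\mathbb N^d$, be the products $p_\kappa(x)=\prod_i p_{\kappa_i}^{\alpha_i,\beta_i}(x_i)$ of one-dimensional Jacobi polynomials normalized in $L^2$ of the one-dimensional normalized Jacobi measures, let $\lambda_\kappa=\sum_{i=1}^d\kappa_i(\kappa_i+\alpha_i+\beta_i+1)$, so that $\mathcal L p_\kappa=-\lambda_\kappa p_\kappa$ for the Jacobi operator $\mathcal L$, and write $\hat f(\kappa)=\int f p_\kappa\,d\mu$. For $t>0$ let $$T_tf(x)=\int f(y)\sum_{\kappa}e^{-\lambda_\kappa t}p_\kappa(x)p_\kappa(y)\,\mu(dy),\qquad P_tf(x)=\frac1{\sqrt\pi}\int_0^\infty \frac{e^{-u}}{\sqrt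 u}\,T_{t^2/4u}f(x)\,du,\qquad Q_tf(x)=-t\,\frac{\partial}{\partial t}P_tf(x).$$ For a polynomial $q$ put $D_\gamma q=(-\mathcal L)^{\gamma/2}q=\sum_\kappa\lambda_\kappa^{\gamma/2}\hat q(\kappa)p_\kappa$ and $I_\gamma q=\sum_{\kappa\ne0}\lambda_\kappa^{-\gamma/2}\hat q(\kappa)p_\kappa$. For $1<p<\infty$ let $L^p_\gamma$ be the completion of the polynomials in the norm $\|q\|_{p,\gamma}=\|(I-\mathcal L)^{\gamma/2}q\|_{L^p(\mu)}$, regarded as a subspace of $L^p(\mu)$. For $f\in\bigcup_{p>1}L^p_\gamma$ let $D_\gamma f$ be the $L^p$-limit of $D_\gamma q_n$, where the $q_n$ are polynomials with $q_n\to f$ in $L^p_\gamma$; for $f\in L^p(\mu)$, $1<p<\infty$, let $I_\gamma f$ be the $L^p$-limit of $I_\gamma q_n$, where $q_n$ are polynomials with $q_n\to f$ in $L^p(\mu)$ for which this limit exists. Finally let $c_\gamma=\int_0^\infty s^{-\gamma-1}(e^{-s}-1)\,ds$ for $0<\gamma<1$. Let $f:[-1,1]^d\to\mathbb R$ be of class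 $C^2$ with $\int f\,d\mu=0$. Then for $\mu$-almost every $x$ the function $t\mapsto P_tf(x)$ is differentiable on $(0,\infty)$, and: 1. for every $0<\gamma<1$, $D_\gamma f$ exists (that is, $f\in\bigcup_{p>1}L^p_\gamma$), is independent of the choice of $p$ and of the sequence $q_n$, and for $\mu$-almost every $x$ $$-\gamma D_\gamma f(x)=\frac1{c_\gamma}\int_0^\infty t^{-\gamma-1}Q_tf(x)\,dt;$$ 2. for every $\gamma>0$, $I_\gamma f$ exists, is independent of the choice of $p$ and of the sequence $q_n$, and for $\mu$-almost every $x$ $$\gamma I_\gamma f(x)=\frac1{\Gamma(\gamma)}\int_0^\infty t^{\gamma-1}Q_tf(x)\,dt.$$ For $\mu$-almost every $x$ the integrals converge absolutely. -/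

import Mathlib

open Set Filter Topology MeasureTheory
open scoped ENNReal

noncomputable section

namespace JacobiExpansion

/-! ### Jacobi measure and normalized Jacobi polynomials -/

/-- The normalized Jacobi measure on `[-1,1]`, with density
`(1-x)^a (1+x)^b / (2^(a+b+1) B(a+1,b+1))`. -/
def jacobiMeasureOne (a b : ℝ) : Measure ℝ :=
  (volume.restrict (Icc (-1 : ℝ) 1)).withDensity fun x =>
    ENNReal.ofReal ((1 - x) ^ a * (1 + x) ^ b /
      (2 ^ (a + b + 1) * ProbabilityTheory.beta (a + 1) (b + 1)))

/-- The normalized Jacobi measure on `[-1,1]^d` (a product measure). -/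
def jacobiMeasure {d : ℕ} (α β : Fin d → ℝ) : Measure (Fin d → ℝ) :=
  Measure.pi fun i => jacobiMeasureOne (α i) (β i)

/-- The classical Jacobi polynomial `P_n^{(a,b)}`, in the form obtained by expanding
Rodrigues' formula with the Leibniz rule (see `jacobiP_rodrigues`). -/
def jacobiP (a b : ℝ) (n : ℕ) (x : ℝ) : ℝ :=
  ∑ i ∈ Finset.range (n + 1),
    Ring.choose (a + n) i * Ring.choose (b + n) (n - i) *
      ((x - 1) / 2) ^ (n - i) * ((x + 1) / 2) ^ i

/-- Rodrigues' formula. -/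
theorem jacobiP_rodrigues (a b : ℝ) (n : ℕ) {x : ℝ} (hx : x ∈ Ioo (-1 : ℝ) 1) :
    (1 - x) ^ a * (1 + x) ^ b * jacobiP a b n x =
      (-1) ^ n / (2 ^ n * n.factorial) *
        iteratedDeriv n (fun y => (1 - y) ^ (a + n) * (1 + y) ^ (b + n)) x := by
  have h1 : 0 < 1 - x := by linarith [hx.2]
  have h2 : 0 < 1 + x := by linarith [hx.1]
  have hch : ∀ (r : ℝ) (k : ℕ), (descPochhammer ℝ k).eval r = k.factorial * Ring.choose r k := by
    intro r k
    rw [← nsmul_eq_mul, ← Ring.descPochhammer_eq_factorial_smul_choose r k,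
      ← descPochhammer_map (Int.castRingHom ℝ), Polynomial.eval_map,
      ← Polynomial.eval₂_smulOneHom_eq_smeval]
    congr 1
    exact Subsingleton.elim _ _
  have hd : ∀ (r y : ℝ) (k : ℕ), iteratedDeriv k (fun z : ℝ => z ^ r) y =
      k.factorial * Ring.choose r k * y ^ (r - k) := by
    intro r y k
    rw [iteratedDeriv_eq_iterate, Real.iter_deriv_rpow_const, hch]
  have c1 : ContDiffAt ℝ n (fun y : ℝ => (1 - y) ^ (a + n)) x :=
    ContDiffAt.rpow_const_of_ne (by fun_prop) h1.ne'
  have c2 : ContDiffAt ℝ n (fun y : ℝ => (1 + y) ^ (b + n)) x :=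
    ContDiffAt.rpow_const_of_ne (by fun_prop) h2.ne'
  rw [iteratedDeriv_fun_mul c1 c2, jacobiP, Finset.mul_sum, Finset.mul_sum]
  refine Finset.sum_congr rfl fun i hi => ?_
  have hin : i ≤ n := Nat.lt_succ_iff.mp (Finset.mem_range.mp hi)
  rw [iteratedDeriv_comp_const_sub i (fun z : ℝ => z ^ (a + n)) 1,
    iteratedDeriv_comp_const_add (n - i) (fun z : ℝ => z ^ (b + n)) 1]
  simp only [hd, smul_eq_mul]
  have e1 : (1 - x) ^ (a + n - i) = (1 - x) ^ a * (1 - x) ^ (n - i) := by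
    rw [← Real.rpow_natCast, ← Real.rpow_add h1, Nat.cast_sub hin]; congr 1; ring
  have e2 : (1 + x) ^ (b + n - (n - i : ℕ)) = (1 + x) ^ b * (1 + x) ^ i := by
    rw [← Real.rpow_natCast, ← Real.rpow_add h2, Nat.cast_sub hin]; congr 1; ring
  have hfac : ((n.choose i : ℝ) * i.factorial * (n - i).factorial) = n.factorial := by
    exact_mod_cast Nat.choose_mul_factorial_mul_factorial hin
  have hn : (n.factorial : ℝ) ≠ 0 := by positivity
  have e3 : ((x - 1) / 2) ^ (n - i) = (-1) ^ (n - i) * (1 - x) ^ (n - i) / 2 ^ (n - i) := by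
    rw [← mul_pow, ← div_pow]; congr 1; ring
  have e4 : ((x + 1) / 2) ^ i = (1 + x) ^ i / 2 ^ i := by
    rw [← div_pow]; congr 1; ring
  have e5 : (2 : ℝ) ^ n = 2 ^ (n - i) * 2 ^ i := by rw [← pow_add]; congr 1; omega
  have e6 : (-1 : ℝ) ^ n * (-1) ^ i = (-1) ^ (n - i) := by
    have : n = (n - i) + i := by omega
    conv_lhs => rw [this]
    rw [pow_add, mul_assoc, ← mul_pow]; norm_num
  rw [e1, e2, e3, e4, e5, ← e6, ← hfac]
  have hc : (n.choose i : ℝ) ≠ 0 := by exact_mod_cast (Nat.choose_pos hin).ne'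
  field_simp

/-- The one-dimensional Jacobi polynomial, normalized in `L²` of the normalized Jacobi measure. -/
def jacobiPolyOne (a b : ℝ) (n : ℕ) (x : ℝ) : ℝ :=
  jacobiP a b n x / √(∫ y, jacobiP a b n y ^ 2 ∂jacobiMeasureOne a b)

/-- The normalized Jacobi polynomial of multi-index `κ`. -/
def jacobiPoly {d : ℕ} (α β : Fin d → ℝ) (κ : Fin d → ℕ) (x : Fin d → ℝ) : ℝ :=
  ∏ i, jacobiPolyOne (α i) (β i) (κ i) (x i)

/-- `λ_κ`: minus the eigenvalue of the Jacobi operator at the Jacobi polynomial `κ`. -/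
def eigenvalue {d : ℕ} (α β : Fin d → ℝ) (κ : Fin d → ℕ) : ℝ :=
  ∑ i, (κ i : ℝ) * (κ i + α i + β i + 1)

/-- The Jacobi-Fourier coefficient of `f`. -/
def jacobiCoeff {d : ℕ} (α β : Fin d → ℝ) (f : (Fin d → ℝ) → ℝ) (κ : Fin d → ℕ) : ℝ :=
  ∫ y, f y * jacobiPoly α β κ y ∂jacobiMeasure α β

/-! ### Jacobi and Poisson-Jacobi semigroups, and the operators `Q_t` -/

/-- The Jacobi kernel `p(t,x,y)`, for `t > 0`. -/
def jacobiKernel {d : ℕ} (α β : Fin d → ℝ) (t : ℝ) (x y : Fin d → ℝ) : ℝ :=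
  ∑' κ : Fin d → ℕ,
    Real.exp (-eigenvalue α β κ * t) * jacobiPoly α β κ x * jacobiPoly α β κ y

/-- The Jacobi semigroup `T_t`, `t ≥ 0`. -/
def jacobiSemigroup {d : ℕ} (α β : Fin d → ℝ) (t : ℝ) (f : (Fin d → ℝ) → ℝ)
    (x : Fin d → ℝ) : ℝ :=
  if t = 0 then f x else ∫ y, f y * jacobiKernel α β t x y ∂jacobiMeasure α β

/-- The Poisson-Jacobi semigroup `P_t`, `t ≥ 0`, by Bochner's subordination formula. -/
def poissonJacobi {d : ℕ} (α β : Fin d → ℝ) (t : ℝ) (f : (Fin d → ℝ) → ℝ)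
    (x : Fin d → ℝ) : ℝ :=
  1 / √Real.pi * ∫ u in Ioi (0 : ℝ),
    Real.exp (-u) / √u * jacobiSemigroup α β (t ^ 2 / (4 * u)) f x

/-- `Q_t f = -t ∂/∂t P_t f`. -/
def poissonQ {d : ℕ} (α β : Fin d → ℝ) (t : ℝ) (f : (Fin d → ℝ) → ℝ) (x : Fin d → ℝ) : ℝ :=
  -t * deriv (fun s => poissonJacobi α β s f x) t

/-! ### Fractional derivative and fractional integral -/

/-- The spectral operator `Φ(-L)` (`L` the Jacobi operator) on a polynomial `q`; the sum has only
finitely many nonzero terms. -/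
def spectralOp {d : ℕ} (α β : Fin d → ℝ) (Φ : ℝ → ℝ) (q : MvPolynomial (Fin d) ℝ)
    (x : Fin d → ℝ) : ℝ :=
  ∑' κ : Fin d → ℕ,
    Φ (eigenvalue α β κ) * jacobiCoeff α β (fun y => MvPolynomial.eval y q) κ * jacobiPoly α β κ x

/-- `D_γ = (-L)^(γ/2)` on polynomials. -/
def fracDerivPoly {d : ℕ} (α β : Fin d → ℝ) (γ : ℝ) :
    MvPolynomial (Fin d) ℝ → (Fin d → ℝ) → ℝ :=
  spectralOp α β fun r => r ^ (γ / 2)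

/-- `I_γ = (-L)^(-γ/2) Π₀` on polynomials, where `Π₀` removes the constant term
of the Jacobi expansion, that is, the component with eigenvalue `0`. -/
def fracIntPoly {d : ℕ} (α β : Fin d → ℝ) (γ : ℝ) :
    MvPolynomial (Fin d) ℝ → (Fin d → ℝ) → ℝ :=
  spectralOp α β fun r => if r = 0 then 0 else 1 / r ^ (γ / 2)

/-- The potential norm `‖q‖_{p,γ} = ‖(I-L)^(γ/2) q‖_p` of a polynomial. -/
def sobolevNorm {d : ℕ} (α β : Fin d → ℝ) (p : ℝ≥0∞) (γ : ℝ) (q : MvPolynomial (Fin d) ℝ) :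
    ℝ≥0∞ :=
  eLpNorm (spectralOp α β (fun r => (1 + r) ^ (γ / 2)) q) p (jacobiMeasure α β)

/-- The functions `u n` tend to `g` in `L^p` of the Jacobi measure. -/
def TendstoLp {d : ℕ} (α β : Fin d → ℝ) (p : ℝ≥0∞) (u : ℕ → (Fin d → ℝ) → ℝ)
    (g : (Fin d → ℝ) → ℝ) : Prop :=
  MemLp g p (jacobiMeasure α β) ∧
    Tendsto (fun n => eLpNorm (u n - g) p (jacobiMeasure α β)) atTop (𝓝 0)

/-- The polynomials `q n` tend to `f` in the Jacobi Sobolev space `L^p_γ`, the completion of the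
polynomials for `‖·‖_{p,γ}`, realized inside `L^p`: the sequence is Cauchy for `‖·‖_{p,γ}`, and its
limit in `L^p` is `f`. -/
def TendstoSobolev {d : ℕ} (α β : Fin d → ℝ) (p : ℝ≥0∞) (γ : ℝ)
    (q : ℕ → MvPolynomial (Fin d) ℝ) (f : (Fin d → ℝ) → ℝ) : Prop :=
  (∀ ε : ℝ≥0∞, 0 < ε → ∃ N, ∀ m ≥ N, ∀ n ≥ N, sobolevNorm α β p γ (q m - q n) < ε) ∧
    TendstoLp α β p (fun n x => MvPolynomial.eval x (q n)) f

/-- `f` is in the domain `⋃_{p>1} L^p_γ` of `D_γ`, and `D_γ f = g`: the limit in `L^p` of the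
`D_γ (q n)` is `g`, for polynomials `q n` that tend to `f` in `L^p_γ`. -/
def IsFracDeriv {d : ℕ} (α β : Fin d → ℝ) (γ : ℝ) (f g : (Fin d → ℝ) → ℝ) : Prop :=
  ∃ p : ℝ≥0∞, 1 < p ∧ p < ∞ ∧ ∃ q : ℕ → MvPolynomial (Fin d) ℝ,
    TendstoSobolev α β p γ q f ∧ TendstoLp α β p (fun n => fracDerivPoly α β γ (q n)) g

/-- `f` is in `L^p` for some `1 < p < ∞`, and `I_γ f = g`, where `I_γ` is extended from the
polynomials to `L^p` by continuity. -/
def IsFracInt {d : ℕ} (α β : Fin d → ℝ) (γ : ℝ) (f g : (Fin d → ℝ) → ℝ) : Prop :=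
  ∃ p : ℝ≥0∞, 1 < p ∧ p < ∞ ∧ ∃ q : ℕ → MvPolynomial (Fin d) ℝ,
    TendstoLp α β p (fun n x => MvPolynomial.eval x (q n)) f ∧
      TendstoLp α β p (fun n => fracIntPoly α β γ (q n)) g

/-- `c_γ = ∫₀^∞ s^(-γ-1) (e^(-s) - 1) ds`. -/
def cConst (γ : ℝ) : ℝ :=
  ∫ s in Ioi (0 : ℝ), s ^ (-γ - 1) * (Real.exp (-s) - 1)

end JacobiExpansion

end

open Set Filter Topology MeasureTheory
open scoped ENNReal

noncomputable section

namespace JacobiExpansion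

/-! ### Algebra of the Jacobi polynomials -/

/-! Both formulas are one identity between Jacobi coefficients. Put `r = √λ_κ`. By subordination
`P_t f` has coefficients `exp(-t r) f̂(κ)`, so `Q_t f` has coefficients `t r exp(-t r) f̂(κ)`, and
for `σ > -1` `∫₀^∞ t^(σ-1) · t r exp(-t r) dt = Γ(σ+1) r^(-σ)` when `r > 0`, while the integral is
`0` when `r = 0`. Taking `σ = γ` gives the multiplier of `I_γ` with `Γ(γ+1) = γ Γ(γ)`. Taking `σ =
-γ` gives that of `D_γ`, and an integration by parts gives `c_γ = -Γ(1-γ)/γ`.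

An integrable function on the cube is determined almost everywhere by its coefficients
(`ae_eq_zero_of_jacobiCoeff_eq_zero`, from Stone–Weierstrass). It is therefore enough to compare
coefficients of integrable functions; neither pointwise bounds on Jacobi polynomials nor `L^p`
multiplier theorems are needed.

Three points remain. (1) Pointwise meaning of the series: for almost every `x`, `∑ |p_κ(x)| exp(-t
r_κ)` is finite for all `t > 0` (`ae_summable_abs_mul_exp`), because `∫ |p_κ| dμ` is bounded in `κ`.
This justifies the kernel expansion, subordination and differentiation in `t`. (2) Fubini in `(t,
x)`: `‖Q_t f‖₁ ≤ K t exp(-t)` (`integrable_poissonQSeries`). The decay comes from the gap `r = 0` or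
`r ≥ 1`, the factor `t` from `∑ (r f̂(κ))² < ∞`. The latter is Bessel's inequality for the Jacobi
operator applied to `f`, whose coefficients are `-λ_κ f̂(κ)` by symmetry of the operator. (3)
Existence and uniqueness of `D_γ f` and `I_γ f`: partial sums converge in `L²` by Riesz–Fischer, and
coefficients are continuous in every `L^p`, so any admissible limit has the prescribed coefficients.
-/

theorem factorial_mul_choose (r : ℝ) (k : ℕ) :
    k.factorial * Ring.choose r k = (descPochhammer ℝ k).eval r := by
  rw [← nsmul_eq_mul, ← Ring.descPochhammer_eq_factorial_smul_choose r k,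
    ← descPochhammer_map (Int.castRingHom ℝ), Polynomial.eval_map,
    ← Polynomial.eval₂_smulOneHom_eq_smeval]
  congr 1
  exact Subsingleton.elim _ _

theorem succ_mul_choose (r : ℝ) (k : ℕ) :
    (k + 1) * Ring.choose r (k + 1) = Ring.choose r k * (r - k) := by
  have h1 := factorial_mul_choose r k
  have h2 := factorial_mul_choose r (k + 1)
  rw [descPochhammer_succ_eval, ← h1, Nat.factorial_succ] at h2
  have : (k.factorial : ℝ) ≠ 0 := by positivity
  push_cast at h2
  exact mul_left_cancel₀ this (by linarith)

theorem choose_pos {r : ℝ} {k : ℕ} (h : (k : ℝ) - 1 < r) : 0 < Ring.choose r k := by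
  have h1 := factorial_mul_choose r k
  have h2 := descPochhammer_pos h
  rw [← h1] at h2
  exact pos_of_mul_pos_right h2 (by positivity)

open Polynomial in
/-- The Jacobi polynomial as an element of `ℝ[X]`. -/
def jacobiPolynomial (a b : ℝ) (n : ℕ) : Polynomial ℝ :=
  ∑ i ∈ Finset.range (n + 1), C (Ring.choose (a + n) i * Ring.choose (b + n) (n - i)) *
    (C (1 / 2) * X + C (-1 / 2)) ^ (n - i) * (C (1 / 2) * X + C (1 / 2)) ^ i

theorem eval_jacobiPolynomial (a b : ℝ) (n : ℕ) (x : ℝ) :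
    (jacobiPolynomial a b n).eval x = jacobiP a b n x := by
  rw [jacobiPolynomial, jacobiP, Polynomial.eval_finsetSum]
  refine Finset.sum_congr rfl fun i _ => ?_
  simp only [Polynomial.eval_mul, Polynomial.eval_C, Polynomial.eval_pow, Polynomial.eval_add,
    Polynomial.eval_X]
  congr 2
  · congr 1; ring
  · ring

open Polynomial in
theorem natDegree_jacobiPolynomial_le (a b : ℝ) (n : ℕ) :
    (jacobiPolynomial a b n).natDegree ≤ n := by
  refine natDegree_sum_le_of_forall_le _ _ fun i hi => ?_
  have hin : i ≤ n := Nat.lt_succ_iff.mp (Finset.mem_range.mp hi)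
  have h1 : ∀ c : ℝ, (C (1 / 2) * X + C c : ℝ[X]).natDegree ≤ 1 := fun c => natDegree_linear_le
  calc _ ≤ 0 + (n - i) * 1 + i * 1 := by
        refine natDegree_mul_le_of_le (natDegree_mul_le_of_le (natDegree_C _).le ?_) ?_
        · exact natDegree_pow_le_of_le _ (h1 _)
        · exact natDegree_pow_le_of_le _ (h1 _)
    _ = n := by omega

open Polynomial in
-- Every summand contributes `2^(-n)` times a product of two binomials, and Vandermonde's identity
-- adds these up. For `a + b > -1` the result is positive, so the degree is exactly `n`.
theorem coeff_jacobiPolynomial (a b : ℝ) (n : ℕ) :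
    (jacobiPolynomial a b n).coeff n = (1 / 2) ^ n * Ring.choose (a + n + (b + n)) n := by
  rw [Ring.add_choose_eq n (Commute.all _ _), Finset.Nat.sum_antidiagonal_eq_sum_range_succ_mk,
    jacobiPolynomial, finsetSum_coeff, Finset.mul_sum]
  refine Finset.sum_congr rfl fun i hi => ?_
  have hin : i ≤ n := Nat.lt_succ_iff.mp (Finset.mem_range.mp hi)
  have h1 : ∀ c : ℝ, (C (1 / 2) * X + C c : ℝ[X]).natDegree ≤ 1 := fun c => natDegree_linear_le
  have h2 : ∀ (c : ℝ) (k : ℕ), ((C (1 / 2) * X + C c : ℝ[X]) ^ k).coeff k = (1 / 2) ^ k := by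
    intro c k
    have := coeff_pow_of_natDegree_le (h1 c) (m := k)
    simpa using this
  have h3 : ((C (1 / 2) * X + C (-1 / 2) : ℝ[X]) ^ (n - i) *
      (C (1 / 2) * X + C (1 / 2)) ^ i).coeff (n - i + i) = (1 / 2) ^ (n - i) * (1 / 2) ^ i := by
    rw [coeff_mul_add_eq_of_natDegree_le, h2, h2]
    · exact (natDegree_pow_le_of_le _ (h1 _)).trans (by simp)
    · exact (natDegree_pow_le_of_le _ (h1 _)).trans (by simp)
  rw [Nat.sub_add_cancel hin, ← pow_add, Nat.sub_add_cancel hin] at h3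
  rw [mul_assoc, coeff_C_mul, h3]
  ring

theorem coeff_jacobiPolynomial_pos {a b : ℝ} (h : -1 < a + b) (n : ℕ) :
    0 < (jacobiPolynomial a b n).coeff n := by
  rw [coeff_jacobiPolynomial]
  refine mul_pos (by positivity) (choose_pos ?_)
  have : (0 : ℝ) ≤ n := Nat.cast_nonneg n
  linarith

theorem jacobiPolynomial_ne_zero {a b : ℝ} (h : -1 < a + b) (n : ℕ) :
    jacobiPolynomial a b n ≠ 0 := fun h0 => by
  have := coeff_jacobiPolynomial_pos h n
  simp [h0] at this

theorem degree_jacobiPolynomial {a b : ℝ} (h : -1 < a + b) (n : ℕ) :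
    (jacobiPolynomial a b n).degree = n :=
  Polynomial.degree_eq_of_le_of_coeff_ne_zero
    (Polynomial.degree_le_of_natDegree_le (natDegree_jacobiPolynomial_le a b n))
    (coeff_jacobiPolynomial_pos h n).ne'

/-- The Jacobi polynomials span all polynomials. -/
theorem span_jacobiPolynomial {a b : ℝ} (h : -1 < a + b) :
    Submodule.span ℝ (range (jacobiPolynomial a b)) = ⊤ :=
  Polynomial.Sequence.span (S := ⟨jacobiPolynomial a b, degree_jacobiPolynomial h⟩)
    fun i => (Polynomial.leadingCoeff_ne_zero.mpr (jacobiPolynomial_ne_zero h i)).isUnit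

/-- With `x = 2u + 1` the summands are `c i * u^(n-i) * (u+1)^i`. The operator sends each one to a
diagonal term `M` and two neighbours `A`, `B`; after an index shift the neighbours cancel the
diagonal terms. -/
theorem derivative_jacobiPolynomial_ode (a b : ℝ) (n : ℕ) (x : ℝ) :
    (1 - x ^ 2) * (jacobiPolynomial a b n).derivative.derivative.eval x +
      (b - a - (a + b + 2) * x) * (jacobiPolynomial a b n).derivative.eval x =
      -(n * (n + a + b + 1)) * (jacobiPolynomial a b n).eval x := by
  obtain ⟨u, rfl⟩ : ∃ u, x = 2 * u + 1 := ⟨(x - 1) / 2, by ring⟩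
  set c : ℕ → ℝ := fun i => Ring.choose (a + n) i * Ring.choose (b + n) (n - i) with hc
  set A : ℕ → ℝ := fun i => c i * ((n - i : ℕ) * ((n - i : ℕ) + a)) * u ^ (n - i - 1) *
    (u + 1) ^ (i + 1)
  set B : ℕ → ℝ := fun i => c i * (i * (i + b)) * u ^ (n - i + 1) * (u + 1) ^ (i - 1)
  set M : ℕ → ℝ := fun i => c i * (i * (b + i) + (n - i : ℕ) * (a + (n - i : ℕ))) * u ^ (n - i) *
    (u + 1) ^ i
  -- The last `A` and the first term on the right vanish; the others match under `i ↦ i + 1` by two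
  -- uses of `succ_mul_choose`. The sum of `B` is treated by the opposite shift.
  have hA : ∑ i ∈ Finset.range (n + 1), A i =
      ∑ i ∈ Finset.range (n + 1), c i * (i * (b + i)) * u ^ (n - i) * (u + 1) ^ i := by
    rw [Finset.sum_range_succ, Finset.sum_range_succ']
    simp only [A, Nat.sub_self, CharP.cast_eq_zero, zero_mul, mul_zero, add_zero]
    refine Finset.sum_congr rfl fun i hi => ?_
    have hin : i + 1 ≤ n := Finset.mem_range.mp hi
    have e : n - i = n - (i + 1) + 1 := by omega
    have h1 := succ_mul_choose (a + n) i
    have h2 := succ_mul_choose (b + n) (n - (i + 1))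
    have e2 : ((n - (i + 1) : ℕ) : ℝ) = n - (i + 1) := by rw [Nat.cast_sub hin]; push_cast; ring
    simp only [hc]
    rw [e]
    rw [e2] at h2
    simp only [Nat.add_sub_cancel]
    push_cast
    rw [e2]
    linear_combination ((n - (i + 1) + 1 : ℝ) + a) * Ring.choose (a + n) i *
      u ^ (n - (i + 1)) * (u + 1) ^ (i + 1) * h2 - (b + (i + 1)) *
      Ring.choose (b + n) (n - (i + 1)) * u ^ (n - (i + 1)) * (u + 1) ^ (i + 1) * h1
  have hB : ∑ i ∈ Finset.range (n + 1), B i = ∑ i ∈ Finset.range (n + 1),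
      c i * ((n - i : ℕ) * (a + (n - i : ℕ))) * u ^ (n - i) * (u + 1) ^ i := by
    rw [Finset.sum_range_succ', Finset.sum_range_succ]
    simp only [B, Nat.sub_self, CharP.cast_eq_zero, zero_mul, mul_zero, add_zero]
    refine Finset.sum_congr rfl fun i hi => ?_
    have hin : i + 1 ≤ n := Finset.mem_range.mp hi
    have e : n - i = n - (i + 1) + 1 := by omega
    have h1 := succ_mul_choose (a + n) i
    have h2 := succ_mul_choose (b + n) (n - (i + 1))
    have e2 : ((n - (i + 1) : ℕ) : ℝ) = n - (i + 1) := by rw [Nat.cast_sub hin]; push_cast; ring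
    simp only [hc]
    rw [e]
    rw [e2] at h2
    simp only [Nat.add_sub_cancel]
    push_cast
    rw [e2]
    linear_combination ((i + 1 : ℝ) + b) * Ring.choose (b + n) (n - (i + 1)) *
      u ^ (n - (i + 1) + 1) * (u + 1) ^ i * h1 - (a + (n - (i + 1) + 1)) *
      Ring.choose (a + n) i * u ^ (n - (i + 1) + 1) * (u + 1) ^ i * h2
  have key : ∀ i ∈ Finset.range (n + 1), (1 - (2 * u + 1) ^ 2) *
      (Polynomial.derivative (Polynomial.derivative
        (Polynomial.C (c i) * (Polynomial.C (1 / 2) * Polynomial.X + Polynomial.C (-1 / 2)) ^ (n - i)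
        * (Polynomial.C (1 / 2) * Polynomial.X + Polynomial.C (1 / 2)) ^ i))).eval (2 * u + 1)
      + (b - a - (a + b + 2) * (2 * u + 1)) * (Polynomial.derivative
        (Polynomial.C (c i) * (Polynomial.C (1 / 2) * Polynomial.X + Polynomial.C (-1 / 2)) ^ (n - i)
        * (Polynomial.C (1 / 2) * Polynomial.X + Polynomial.C (1 / 2)) ^ i)).eval (2 * u + 1)
      + n * (n + a + b + 1) * (Polynomial.C (c i) * (Polynomial.C (1 / 2) * Polynomial.X +
        Polynomial.C (-1 / 2)) ^ (n - i) * (Polynomial.C (1 / 2) * Polynomial.X +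
        Polynomial.C (1 / 2)) ^ i).eval (2 * u + 1) = -A i - B i + M i := by
    intro i hi
    have hin : i ≤ n := Nat.lt_succ_iff.mp (Finset.mem_range.mp hi)
    obtain ⟨m, rfl⟩ := Nat.exists_eq_add_of_le hin
    simp only [A, B, M, Nat.add_sub_cancel_left]
    have e1 : (1 / 2 : ℝ) * (2 * u + 1) + -1 / 2 = u := by ring
    have e2 : (1 / 2 : ℝ) * (2 * u + 1) + 1 / 2 = u + 1 := by ring
    simp only [Polynomial.derivative_mul, Polynomial.derivative_add, Polynomial.derivative_C,
      Polynomial.derivative_pow, Polynomial.derivative_X, Polynomial.eval_add, Polynomial.eval_mul,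
      Polynomial.eval_C, Polynomial.eval_pow, Polynomial.eval_X, Polynomial.eval_zero,
      Polynomial.eval_one,
      Polynomial.derivative_one, Polynomial.derivative_zero, e1, e2]
    -- Two derivatives produce truncated exponents, so the exponents 0 and 1 are separated from the
    -- generic case.
    rcases m with _ | _ | m <;> rcases i with _ | _ | i <;>
      simp only [Nat.add_sub_cancel, Nat.sub_self, zero_add, Nat.zero_sub, CharP.cast_eq_zero,
        pow_zero] <;>
      push_cast <;> ring
  have hsum := Finset.sum_congr rfl key
  have hM : ∑ i ∈ Finset.range (n + 1), M i =
      ∑ i ∈ Finset.range (n + 1), A i + ∑ i ∈ Finset.range (n + 1), B i := by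
    rw [hA, hB, ← Finset.sum_add_distrib]
    exact Finset.sum_congr rfl fun i _ => by simp only [M]; ring
  rw [Finset.sum_add_distrib, Finset.sum_add_distrib, Finset.sum_add_distrib,
    Finset.sum_sub_distrib, Finset.sum_neg_distrib, hM, ← Finset.mul_sum, ← Finset.mul_sum,
    ← Finset.mul_sum, ← Polynomial.eval_finsetSum, ← Polynomial.eval_finsetSum,
    ← Polynomial.eval_finsetSum, ← Polynomial.derivative_sum, ← Polynomial.derivative_sum] at hsum
  change _ * (Polynomial.derivative (Polynomial.derivative (jacobiPolynomial a b n))).eval _ +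
    _ * (Polynomial.derivative (jacobiPolynomial a b n)).eval _ +
    _ * (jacobiPolynomial a b n).eval _ = _ at hsum
  linarith

/-! ### The one-dimensional Jacobi measure -/

/-- The density of the normalized Jacobi measure. -/
def jacobiWeight (a b x : ℝ) : ℝ :=
  (1 - x) ^ a * (1 + x) ^ b / (2 ^ (a + b + 1) * ProbabilityTheory.beta (a + 1) (b + 1))

theorem jacobiWeight_const_pos {a b : ℝ} (ha : -1 < a) (hb : -1 < b) :
    0 < (2 : ℝ) ^ (a + b + 1) * ProbabilityTheory.beta (a + 1) (b + 1) :=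
  mul_pos (by positivity) (ProbabilityTheory.beta_pos (by linarith) (by linarith))

theorem jacobiWeight_nonneg {a b x : ℝ} (ha : -1 < a) (hb : -1 < b) (hx : x ∈ Icc (-1 : ℝ) 1) :
    0 ≤ jacobiWeight a b x :=
  div_nonneg (mul_nonneg (Real.rpow_nonneg (by linarith [hx.2]) _)
    (Real.rpow_nonneg (by linarith [hx.1]) _)) (jacobiWeight_const_pos ha hb).le

theorem jacobiWeight_pos {a b x : ℝ} (ha : -1 < a) (hb : -1 < b) (hx : x ∈ Ioo (-1 : ℝ) 1) :
    0 < jacobiWeight a b x :=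
  div_pos (mul_pos (Real.rpow_pos_of_pos (by linarith [hx.2]) _)
    (Real.rpow_pos_of_pos (by linarith [hx.1]) _)) (jacobiWeight_const_pos ha hb)

@[fun_prop]
theorem measurable_jacobiWeight (a b : ℝ) : Measurable (jacobiWeight a b) := by
  unfold jacobiWeight; fun_prop

theorem integrableOn_jacobiWeight {a b : ℝ} (ha : -1 < a) (hb : -1 < b) :
    IntegrableOn (jacobiWeight a b) (Icc (-1) 1) := by
  have h1 : IntervalIntegrable (fun x : ℝ => (1 - x) ^ a) volume (-1) 1 := by
    have := (intervalIntegral.intervalIntegrable_rpow' ha (a := 0) (b := 2)).comp_sub_left 1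
    norm_num at this
    exact this.symm
  have h2 : IntervalIntegrable (fun x : ℝ => (1 + x) ^ b) volume (-1) 1 := by
    have := (intervalIntegral.intervalIntegrable_rpow' hb (a := 0) (b := 2)).comp_add_left 1
    norm_num at this
    exact this
  -- On each half of the interval only one factor of the weight can be singular; the other has its
  -- base in `[1, 2]`.
  have hbd : ∀ (r y : ℝ), 1 ≤ y → y ≤ 2 → y ^ r ≤ 2 ^ |r| := fun r y h1 h2 =>
    (Real.rpow_le_rpow_of_exponent_le h1 (le_abs_self r)).trans
      (Real.rpow_le_rpow (by linarith) h2 (abs_nonneg r))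
  rw [intervalIntegrable_iff_integrableOn_Icc_of_le (by norm_num)] at h1 h2
  have h3 : IntegrableOn (fun x : ℝ => (1 - x) ^ a * (1 + x) ^ b) (Icc (-1) 1) := by
    refine Integrable.mono' ((h1.const_mul (2 ^ |b|)).add (h2.const_mul (2 ^ |a|)))
      (by fun_prop) ?_
    rw [ae_restrict_iff' measurableSet_Icc]
    refine ae_of_all _ fun x hx => ?_
    have p1 : 0 ≤ (1 - x) ^ a := Real.rpow_nonneg (by linarith [hx.2]) _
    have p2 : 0 ≤ (1 + x) ^ b := Real.rpow_nonneg (by linarith [hx.1]) _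
    have q1 : (0 : ℝ) ≤ 2 ^ |a| := by positivity
    have q2 : (0 : ℝ) ≤ 2 ^ |b| := by positivity
    rw [Real.norm_eq_abs, abs_of_nonneg (mul_nonneg p1 p2), Pi.add_apply]
    rcases le_total 0 x with h | h
    · have := hbd b (1 + x) (by linarith) (by linarith [hx.2])
      nlinarith [mul_nonneg q1 p2, mul_le_mul_of_nonneg_left this p1]
    · have := hbd a (1 - x) (by linarith) (by linarith [hx.1])
      nlinarith [mul_nonneg q2 p1, mul_le_mul_of_nonneg_right this p2]
  exact h3.div_const _

theorem jacobiMeasureOne_eq (a b : ℝ) : jacobiMeasureOne a b =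
    (volume.restrict (Icc (-1 : ℝ) 1)).withDensity fun x => ENNReal.ofReal (jacobiWeight a b x) :=
  rfl

theorem isFiniteMeasure_jacobiMeasureOne {a b : ℝ} (ha : -1 < a) (hb : -1 < b) :
    IsFiniteMeasure (jacobiMeasureOne a b) := by
  rw [jacobiMeasureOne_eq]
  exact isFiniteMeasure_withDensity_ofReal (integrableOn_jacobiWeight ha hb).2

theorem jacobiMeasureOne_absolutelyContinuous (a b : ℝ) :
    jacobiMeasureOne a b ≪ volume.restrict (Icc (-1 : ℝ) 1) :=
  withDensity_absolutelyContinuous _ _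

theorem ae_mem_Icc_jacobiMeasureOne (a b : ℝ) :
    ∀ᵐ x ∂jacobiMeasureOne a b, x ∈ Icc (-1 : ℝ) 1 :=
  (jacobiMeasureOne_absolutelyContinuous a b).ae_le (ae_restrict_mem measurableSet_Icc)

theorem jacobiMeasureOne_ne_zero {a b : ℝ} (ha : -1 < a) (hb : -1 < b) :
    jacobiMeasureOne a b ≠ 0 := by
  intro h
  rw [jacobiMeasureOne_eq, withDensity_eq_zero_iff (by fun_prop), EventuallyEq,
    ae_restrict_iff' measurableSet_Icc] at h
  have h2 : (Ioo (-1 : ℝ) 1) ⊆ {x | ¬ (x ∈ Icc (-1 : ℝ) 1 →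
      ENNReal.ofReal (jacobiWeight a b x) = (0 : ℝ → ℝ≥0∞) x)} := by
    intro x hx hc
    have := hc ⟨hx.1.le, hx.2.le⟩
    rw [Pi.zero_apply, ENNReal.ofReal_eq_zero] at this
    exact (jacobiWeight_pos ha hb hx).not_ge this
  have h3 := measure_mono_null h2 h
  rw [Real.volume_Ioo, ENNReal.ofReal_eq_zero] at h3
  norm_num at h3

theorem integral_jacobiMeasureOne {a b : ℝ} (ha : -1 < a) (hb : -1 < b) (g : ℝ → ℝ) :
    ∫ x, g x ∂jacobiMeasureOne a b = ∫ x in (-1 : ℝ)..1, jacobiWeight a b x * g x := by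
  rw [jacobiMeasureOne_eq, integral_withDensity_eq_integral_toReal_smul (by fun_prop)
    (ae_of_all _ fun _ => ENNReal.ofReal_lt_top), intervalIntegral.integral_of_le (by norm_num),
    ← integral_Icc_eq_integral_Ioc]
  refine setIntegral_congr_fun measurableSet_Icc fun x hx => ?_
  simp only [ENNReal.toReal_ofReal (jacobiWeight_nonneg ha hb hx), smul_eq_mul]

theorem integrable_jacobiMeasureOne_of_continuousOn {a b : ℝ} (ha : -1 < a) (hb : -1 < b) {g : ℝ → ℝ}
    (hg : ContinuousOn g (Icc (-1) 1)) : Integrable g (jacobiMeasureOne a b) := by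
  have := isFiniteMeasure_jacobiMeasureOne ha hb
  obtain ⟨C, hC⟩ := isCompact_Icc.exists_bound_of_continuousOn hg
  refine Integrable.of_bound ?_ C ((ae_mem_Icc_jacobiMeasureOne a b).mono fun x hx => hC x hx)
  exact (hg.aestronglyMeasurable measurableSet_Icc).mono_ac
    (jacobiMeasureOne_absolutelyContinuous a b)

/-- Symmetry of the Jacobi operator `(1 - x²) g'' + (b - a - (a + b + 2) x) g'`. -/
theorem integral_jacobiOperator_symm {a b : ℝ} (ha : -1 < a) (hb : -1 < b)
    {g g' g'' h h' h'' : ℝ → ℝ}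
    (cg : ContinuousOn g (Icc (-1) 1)) (cg' : ContinuousOn g' (Icc (-1) 1))
    (cg'' : ContinuousOn g'' (Icc (-1) 1)) (ch : ContinuousOn h (Icc (-1) 1))
    (ch' : ContinuousOn h' (Icc (-1) 1)) (ch'' : ContinuousOn h'' (Icc (-1) 1))
    (dg : ∀ x ∈ Ioo (-1 : ℝ) 1, HasDerivAt g (g' x) x)
    (dg' : ∀ x ∈ Ioo (-1 : ℝ) 1, HasDerivAt g' (g'' x) x)
    (dh : ∀ x ∈ Ioo (-1 : ℝ) 1, HasDerivAt h (h' x) x)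
    (dh' : ∀ x ∈ Ioo (-1 : ℝ) 1, HasDerivAt h' (h'' x) x) :
    ∫ x, ((1 - x ^ 2) * g'' x + (b - a - (a + b + 2) * x) * g' x) * h x ∂jacobiMeasureOne a b =
    ∫ x, ((1 - x ^ 2) * h'' x + (b - a - (a + b + 2) * x) * h' x) * g x ∂jacobiMeasureOne a b := by
  set Z := (2 : ℝ) ^ (a + b + 1) * ProbabilityTheory.beta (a + 1) (b + 1) with hZ
  set u : ℝ → ℝ := fun x =>
    ((1 - x ^ 2) * g'' x + (b - a - (a + b + 2) * x) * g' x) * h x -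
    ((1 - x ^ 2) * h'' x + (b - a - (a + b + 2) * x) * h' x) * g x with hu
  have cu : ContinuousOn u (Icc (-1) 1) := by fun_prop
  have i1 : Integrable (fun x => ((1 - x ^ 2) * g'' x + (b - a - (a + b + 2) * x) * g' x) * h x)
      (jacobiMeasureOne a b) :=
    integrable_jacobiMeasureOne_of_continuousOn ha hb (by fun_prop)
  have i2 : Integrable (fun x => ((1 - x ^ 2) * h'' x + (b - a - (a + b + 2) * x) * h' x) * g x)
      (jacobiMeasureOne a b) :=
    integrable_jacobiMeasureOne_of_continuousOn ha hb (by fun_prop)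
  rw [← sub_eq_zero, ← integral_sub i1 i2, integral_jacobiMeasureOne ha hb]
  -- Lagrange's identity: the weighted Wronskian `F` is a primitive of the integrand, and it
  -- vanishes at both endpoints because `a + 1` and `b + 1` are positive.
  set F : ℝ → ℝ := fun x => (1 - x) ^ (a + 1) * (1 + x) ^ (b + 1) / Z * (g' x * h x - h' x * g x)
  have cF : ContinuousOn F (Icc (-1) 1) := by
    have e1 : ContinuousOn (fun x : ℝ => (1 - x) ^ (a + 1)) (Icc (-1) 1) :=
      ContinuousOn.rpow_const (by fun_prop) fun x _ => Or.inr (by linarith)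
    have e2 : ContinuousOn (fun x : ℝ => (1 + x) ^ (b + 1)) (Icc (-1) 1) :=
      ContinuousOn.rpow_const (by fun_prop) fun x _ => Or.inr (by linarith)
    fun_prop
  have dF : ∀ x ∈ Ioo (-1 : ℝ) 1, HasDerivAt F (jacobiWeight a b x * u x) x := by
    intro x hx
    have h1 : 0 < 1 - x := by linarith [hx.2]
    have h2 : 0 < 1 + x := by linarith [hx.1]
    have e1 := ((hasDerivAt_id x).const_sub 1).rpow_const (p := a + 1) (Or.inl h1.ne')
    have e2 := ((hasDerivAt_id x).const_add 1).rpow_const (p := b + 1) (Or.inl h2.ne')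
    have e3 := ((e1.mul e2).div_const Z).mul
      (((dg' x hx).mul (dh x hx)).sub ((dh' x hx).mul (dg x hx)))
    refine e3.congr_deriv ?_
    simp only [id, add_sub_cancel_right, hu, jacobiWeight, ← hZ, Pi.mul_apply, Pi.sub_apply,
      Real.rpow_add_one h1.ne', Real.rpow_add_one h2.ne']
    ring
  have hi : IntervalIntegrable (fun x => jacobiWeight a b x * u x) volume (-1) 1 := by
    rw [intervalIntegrable_iff_integrableOn_Icc_of_le (by norm_num)]
    exact (integrableOn_jacobiWeight ha hb).mul_continuousOn cu isCompact_Icc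
  change ∫ x in (-1 : ℝ)..1, jacobiWeight a b x * u x = 0
  rw [intervalIntegral.integral_eq_sub_of_hasDerivAt_of_le (by norm_num) cF dF hi]
  have z1 : (0 : ℝ) ^ (a + 1) = 0 := Real.zero_rpow (by linarith)
  have z2 : (0 : ℝ) ^ (b + 1) = 0 := Real.zero_rpow (by linarith)
  simp [F, z1, z2]

/-- Symmetry moves the operator onto `P_n`, where the differential equation applies. It serves both
orthogonality and the coefficients of a `C²` function along coordinate lines. -/
theorem integral_jacobiOperator_mul_jacobiP {a b : ℝ} (ha : -1 < a) (hb : -1 < b) (n : ℕ)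
    {g g' g'' : ℝ → ℝ} (cg : ContinuousOn g (Icc (-1) 1)) (cg' : ContinuousOn g' (Icc (-1) 1))
    (cg'' : ContinuousOn g'' (Icc (-1) 1)) (dg : ∀ x ∈ Ioo (-1 : ℝ) 1, HasDerivAt g (g' x) x)
    (dg' : ∀ x ∈ Ioo (-1 : ℝ) 1, HasDerivAt g' (g'' x) x) :
    ∫ x, ((1 - x ^ 2) * g'' x + (b - a - (a + b + 2) * x) * g' x) * jacobiP a b n x
      ∂jacobiMeasureOne a b =
    -(n * (n + a + b + 1)) * ∫ x, g x * jacobiP a b n x ∂jacobiMeasureOne a b := by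
  simp_rw [← eval_jacobiPolynomial]
  rw [integral_jacobiOperator_symm ha hb cg cg' cg'' (Polynomial.continuousOn _)
    (Polynomial.continuousOn (jacobiPolynomial a b n).derivative)
    (Polynomial.continuousOn (jacobiPolynomial a b n).derivative.derivative) dg dg'
    (fun x _ => Polynomial.hasDerivAt _ x) (fun x _ => Polynomial.hasDerivAt _ x)]
  simp_rw [derivative_jacobiPolynomial_ode]
  rw [← integral_const_mul]
  congr with x
  ring

/-- Eigenfunctions of a symmetric operator: the eigenvalues differ by `(m - n)(m + n + a + b + 1)`,
whose second factor is positive. -/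
theorem integral_jacobiP_mul_jacobiP {a b : ℝ} (ha : -1 < a) (hb : -1 < b) (hab : -1 < a + b)
    {m n : ℕ} (hmn : m ≠ n) :
    ∫ x, jacobiP a b m x * jacobiP a b n x ∂jacobiMeasureOne a b = 0 := by
  have h := integral_jacobiOperator_mul_jacobiP ha hb n (Polynomial.continuousOn _)
    (Polynomial.continuousOn (jacobiPolynomial a b m).derivative)
    (Polynomial.continuousOn (jacobiPolynomial a b m).derivative.derivative)
    (fun x _ => Polynomial.hasDerivAt _ x) (fun x _ => Polynomial.hasDerivAt _ x)
  simp_rw [derivative_jacobiPolynomial_ode, eval_jacobiPolynomial, mul_assoc] at h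
  rw [integral_const_mul] at h
  have h2 : ((m : ℝ) - n) * (m + n + (a + b + 1)) *
      ∫ x, jacobiP a b m x * jacobiP a b n x ∂jacobiMeasureOne a b = 0 := by
    linear_combination -h
  rcases mul_eq_zero.mp h2 with h3 | h3
  · rcases mul_eq_zero.mp h3 with h4 | h4
    · exact absurd (Nat.cast_injective (sub_eq_zero.mp h4)) hmn
    · have : (0 : ℝ) ≤ m := Nat.cast_nonneg m
      have : (0 : ℝ) ≤ n := Nat.cast_nonneg n
      linarith
  · exact h3

theorem continuous_jacobiP (a b : ℝ) (n : ℕ) : Continuous (jacobiP a b n) := by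
  unfold jacobiP; fun_prop

theorem integral_jacobiP_sq_pos {a b : ℝ} (ha : -1 < a) (hb : -1 < b) (hab : -1 < a + b) (n : ℕ) :
    0 < ∫ x, jacobiP a b n x ^ 2 ∂jacobiMeasureOne a b := by
  have hi : Integrable (fun x => jacobiP a b n x ^ 2) (jacobiMeasureOne a b) :=
    integrable_jacobiMeasureOne_of_continuousOn ha hb
      ((continuous_jacobiP a b n).pow 2).continuousOn
  refine (integral_nonneg fun x => sq_nonneg _).lt_of_ne' fun h0 => ?_
  rw [integral_eq_zero_iff_of_nonneg (fun x => sq_nonneg _) hi] at h0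
  have hne : ∀ᵐ x ∂jacobiMeasureOne a b, ¬ (jacobiPolynomial a b n).IsRoot x :=
    (jacobiMeasureOne_absolutelyContinuous a b).ae_le
      (ae_restrict_of_ae (measure_eq_zero_iff_ae_notMem.mp
        ((Polynomial.finite_setOfPred_isRoot (jacobiPolynomial_ne_zero hab n)).measure_zero _)))
  have : ∀ᵐ x ∂jacobiMeasureOne a b, False := by
    filter_upwards [h0, hne] with x h1 h2
    refine h2 ?_
    rw [Polynomial.IsRoot, eval_jacobiPolynomial]
    simpa using h1
  rw [eventually_false_iff_eq_bot, ae_eq_bot] at this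
  exact jacobiMeasureOne_ne_zero ha hb this

theorem continuous_jacobiPolyOne (a b : ℝ) (n : ℕ) : Continuous (jacobiPolyOne a b n) :=
  (continuous_jacobiP a b n).div_const _

theorem integral_jacobiPolyOne_mul {a b : ℝ} (ha : -1 < a) (hb : -1 < b) (hab : -1 < a + b)
    (m n : ℕ) : ∫ x, jacobiPolyOne a b m x * jacobiPolyOne a b n x ∂jacobiMeasureOne a b =
      if m = n then 1 else 0 := by
  simp only [jacobiPolyOne, div_mul_div_comm, integral_div]
  split_ifs with h
  · subst h
    have := integral_jacobiP_sq_pos ha hb hab m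
    simp only [← pow_two, Real.sq_sqrt this.le]
    exact div_self this.ne'
  · rw [integral_jacobiP_mul_jacobiP ha hb hab h, zero_div]

/-- `jacobiPolyOne` as an element of `ℝ[X]`. -/
def jacobiPolynomialOne (a b : ℝ) (n : ℕ) : Polynomial ℝ :=
  (√(∫ y, jacobiP a b n y ^ 2 ∂jacobiMeasureOne a b))⁻¹ • jacobiPolynomial a b n

theorem eval_jacobiPolynomialOne (a b : ℝ) (n : ℕ) (x : ℝ) :
    (jacobiPolynomialOne a b n).eval x = jacobiPolyOne a b n x := by
  rw [jacobiPolynomialOne, Polynomial.eval_smul, eval_jacobiPolynomial, jacobiPolyOne,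
    smul_eq_mul, div_eq_inv_mul]

theorem span_jacobiPolynomialOne {a b : ℝ} (ha : -1 < a) (hb : -1 < b) (hab : -1 < a + b) :
    Submodule.span ℝ (range (jacobiPolynomialOne a b)) = ⊤ := by
  rw [eq_top_iff, ← span_jacobiPolynomial hab, Submodule.span_le]
  rintro _ ⟨n, rfl⟩
  have : √(∫ y, jacobiP a b n y ^ 2 ∂jacobiMeasureOne a b) ≠ 0 :=
    (Real.sqrt_pos.mpr (integral_jacobiP_sq_pos ha hb hab n)).ne'
  have e : jacobiPolynomial a b n = √(∫ y, jacobiP a b n y ^ 2 ∂jacobiMeasureOne a b) •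
      jacobiPolynomialOne a b n := by
    rw [jacobiPolynomialOne, smul_smul, mul_inv_cancel₀ this, one_smul]
  rw [e]
  exact Submodule.smul_mem _ _ (Submodule.subset_span ⟨n, rfl⟩)

/-! ### The Jacobi measure and the Jacobi polynomials on the cube -/

section Cube

variable {d : ℕ} {α β : Fin d → ℝ}

theorem isFiniteMeasure_jacobiMeasure (hα : ∀ i, -(1 / 2 : ℝ) < α i)
    (hβ : ∀ i, -(1 / 2 : ℝ) < β i) : IsFiniteMeasure (jacobiMeasure α β) := by
  have := fun i => isFiniteMeasure_jacobiMeasureOne (a := α i) (b := β i)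
    (by linarith [hα i]) (by linarith [hβ i])
  unfold jacobiMeasure
  infer_instance

theorem ae_mem_Icc_jacobiMeasure (hα : ∀ i, -(1 / 2 : ℝ) < α i) (hβ : ∀ i, -(1 / 2 : ℝ) < β i) :
    ∀ᵐ x ∂jacobiMeasure α β, x ∈ Icc (-1 : Fin d → ℝ) 1 := by
  have := fun i => isFiniteMeasure_jacobiMeasureOne (a := α i) (b := β i)
    (by linarith [hα i]) (by linarith [hβ i])
  have h : ∀ᵐ x ∂jacobiMeasure α β, ∀ i, x i ∈ Icc (-1 : ℝ) 1 := by
    rw [eventually_all]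
    exact fun i => Measure.tendsto_eval_ae_ae.eventually (ae_mem_Icc_jacobiMeasureOne (α i) (β i))
  exact h.mono fun x hx => ⟨fun i => (hx i).1, fun i => (hx i).2⟩

theorem aestronglyMeasurable_jacobiMeasure_of_continuousOn (hα : ∀ i, -(1 / 2 : ℝ) < α i)
    (hβ : ∀ i, -(1 / 2 : ℝ) < β i) {g : (Fin d → ℝ) → ℝ} (hg : ContinuousOn g (Icc (-1) 1)) :
    AEStronglyMeasurable g (jacobiMeasure α β) := by
  have h := hg.aestronglyMeasurable (μ := jacobiMeasure α β) measurableSet_Icc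
  rwa [Measure.restrict_eq_self_of_ae_mem (ae_mem_Icc_jacobiMeasure hα hβ)] at h

theorem memLp_jacobiMeasure_of_continuousOn (hα : ∀ i, -(1 / 2 : ℝ) < α i)
    (hβ : ∀ i, -(1 / 2 : ℝ) < β i) {g : (Fin d → ℝ) → ℝ} (hg : ContinuousOn g (Icc (-1) 1))
    (p : ℝ≥0∞) : MemLp g p (jacobiMeasure α β) := by
  have := isFiniteMeasure_jacobiMeasure hα hβ
  obtain ⟨C, hC⟩ := isCompact_Icc.exists_bound_of_continuousOn hg
  exact MemLp.of_bound (aestronglyMeasurable_jacobiMeasure_of_continuousOn hα hβ hg) C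
    ((ae_mem_Icc_jacobiMeasure hα hβ).mono fun x hx => hC x hx)

theorem integrable_jacobiMeasure_of_continuousOn (hα : ∀ i, -(1 / 2 : ℝ) < α i)
    (hβ : ∀ i, -(1 / 2 : ℝ) < β i) {g : (Fin d → ℝ) → ℝ} (hg : ContinuousOn g (Icc (-1) 1)) :
    Integrable g (jacobiMeasure α β) :=
  memLp_one_iff_integrable.mp (memLp_jacobiMeasure_of_continuousOn hα hβ hg 1)

theorem integrable_mul_jacobiMeasure_of_continuousOn (hα : ∀ i, -(1 / 2 : ℝ) < α i)
    (hβ : ∀ i, -(1 / 2 : ℝ) < β i) {g h : (Fin d → ℝ) → ℝ} (hg : ContinuousOn g (Icc (-1) 1))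
    (hh : Integrable h (jacobiMeasure α β)) :
    Integrable (fun x => h x * g x) (jacobiMeasure α β) := by
  obtain ⟨C, hC⟩ := isCompact_Icc.exists_bound_of_continuousOn hg
  exact hh.mul_bdd (aestronglyMeasurable_jacobiMeasure_of_continuousOn hα hβ hg)
    ((ae_mem_Icc_jacobiMeasure hα hβ).mono fun x hx => hC x hx)

@[fun_prop]
theorem continuous_jacobiPoly (α β : Fin d → ℝ) (κ : Fin d → ℕ) :
    Continuous (jacobiPoly α β κ) := by
  unfold jacobiPoly
  exact continuous_finsetProd _ fun i _ =>
    (continuous_jacobiPolyOne _ _ _).comp (continuous_apply i)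

theorem integral_jacobiPoly_mul (hα : ∀ i, -(1 / 2 : ℝ) < α i) (hβ : ∀ i, -(1 / 2 : ℝ) < β i)
    (κ κ' : Fin d → ℕ) :
    ∫ x, jacobiPoly α β κ x * jacobiPoly α β κ' x ∂jacobiMeasure α β =
      if κ = κ' then 1 else 0 := by
  have := fun i => isFiniteMeasure_jacobiMeasureOne (a := α i) (b := β i)
    (by linarith [hα i]) (by linarith [hβ i])
  simp only [jacobiPoly, jacobiMeasure, ← Finset.prod_mul_distrib]
  rw [integral_fintype_prod_eq_prod (fun i s => jacobiPolyOne (α i) (β i) (κ i) s *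
    jacobiPolyOne (α i) (β i) (κ' i) s)]
  simp_rw [fun i => integral_jacobiPolyOne_mul (a := α i) (b := β i) (by linarith [hα i])
    (by linarith [hβ i]) (by linarith [hα i, hβ i])]
  split_ifs with h
  · simp [h]
  · obtain ⟨i, hi⟩ := Function.ne_iff.mp h
    exact Finset.prod_eq_zero (Finset.mem_univ i) (by simp [hi])

/-- `jacobiPoly` as an element of `ℝ[X₁, …, X_d]`. -/
def jacobiMvPolynomial (α β : Fin d → ℝ) (κ : Fin d → ℕ) : MvPolynomial (Fin d) ℝ :=
  ∏ i, Polynomial.aeval (MvPolynomial.X i) (jacobiPolynomialOne (α i) (β i) (κ i))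

theorem eval_jacobiMvPolynomial (α β : Fin d → ℝ) (κ : Fin d → ℕ) (x : Fin d → ℝ) :
    MvPolynomial.eval x (jacobiMvPolynomial α β κ) = jacobiPoly α β κ x := by
  rw [jacobiMvPolynomial, jacobiPoly, map_prod]
  refine Finset.prod_congr rfl fun i _ => ?_
  rw [← eval_jacobiPolynomialOne]
  have := Polynomial.aeval_algHom_apply (MvPolynomial.aeval (R := ℝ) x) (MvPolynomial.X i)
    (jacobiPolynomialOne (α i) (β i) (κ i))
  rw [MvPolynomial.aeval_X, MvPolynomial.aeval_eq_eval] at this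
  rw [← Polynomial.coe_aeval_eq_eval]
  exact this.symm

/-- Every polynomial is a finite linear combination of Jacobi polynomials. -/
theorem exists_eval_eq_sum_jacobiPoly (hα : ∀ i, -(1 / 2 : ℝ) < α i)
    (hβ : ∀ i, -(1 / 2 : ℝ) < β i) (q : MvPolynomial (Fin d) ℝ) :
    ∃ c : (Fin d → ℕ) →₀ ℝ, ∀ x, MvPolynomial.eval x q =
      ∑ κ ∈ c.support, c κ * jacobiPoly α β κ x := by
  suffices h : (fun x => MvPolynomial.eval x q) ∈
      Submodule.span ℝ (range (jacobiPoly α β)) by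
    obtain ⟨c, hc⟩ := Finsupp.mem_span_range_iff_exists_finsupp.mp h
    refine ⟨c, fun x => ?_⟩
    rw [← congrFun hc x, Finsupp.sum, Finset.sum_apply]
    rfl
  -- Each power `x i ^ m i` is expanded in one variable, and the product of these sums is multiplied
  -- out over a box of multi-indices.
  have hmon : ∀ m : Fin d →₀ ℕ, (fun x : Fin d → ℝ => ∏ i, x i ^ m i) ∈
      Submodule.span ℝ (range (jacobiPoly α β)) := by
    intro m
    have h1 : ∀ i, ∃ c : ℕ →₀ ℝ, ∀ s : ℝ, s ^ m i =
        ∑ k ∈ c.support, c k * jacobiPolyOne (α i) (β i) k s := by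
      intro i
      have h2 : (Polynomial.X ^ m i : Polynomial ℝ) ∈
          Submodule.span ℝ (range (jacobiPolynomialOne (α i) (β i))) := by
        rw [span_jacobiPolynomialOne (by linarith [hα i]) (by linarith [hβ i])
          (by linarith [hα i, hβ i])]
        trivial
      obtain ⟨c, hc⟩ := Finsupp.mem_span_range_iff_exists_finsupp.mp h2
      refine ⟨c, fun s => ?_⟩
      have := congrArg (Polynomial.eval s) hc
      rw [Polynomial.eval_pow, Polynomial.eval_X, Finsupp.sum, Polynomial.eval_finsetSum] at this
      rw [← this]
      refine Finset.sum_congr rfl fun k _ => ?_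
      rw [Polynomial.eval_smul, eval_jacobiPolynomialOne, smul_eq_mul]
    choose c hc using h1
    have h3 : (fun x : Fin d → ℝ => ∏ i, x i ^ m i) =
        ∑ κ ∈ Fintype.piFinset fun i => (c i).support, (∏ i, c i (κ i)) • jacobiPoly α β κ := by
      ext x
      simp_rw [hc, Finset.prod_univ_sum, Finset.prod_mul_distrib, Finset.sum_apply]
      rfl
    rw [h3]
    exact Submodule.sum_mem _ fun κ _ => Submodule.smul_mem _ _ (Submodule.subset_span ⟨κ, rfl⟩)
  have h4 : (fun x => MvPolynomial.eval x q) =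
      ∑ m ∈ q.support, q.coeff m • fun x : Fin d → ℝ => ∏ i, x i ^ m i := by
    ext x
    rw [MvPolynomial.eval_eq', Finset.sum_apply]
    rfl
  rw [h4]
  exact Submodule.sum_mem _ fun m _ => Submodule.smul_mem _ _ (hmon m)

theorem jacobiCoeff_sum (hα : ∀ i, -(1 / 2 : ℝ) < α i) (hβ : ∀ i, -(1 / 2 : ℝ) < β i)
    (s : Finset (Fin d → ℕ)) (c : (Fin d → ℕ) → ℝ) (κ : Fin d → ℕ) :
    jacobiCoeff α β (fun x => ∑ κ' ∈ s, c κ' * jacobiPoly α β κ' x) κ =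
      if κ ∈ s then c κ else 0 := by
  unfold jacobiCoeff
  simp_rw [Finset.sum_mul, mul_assoc]
  rw [integral_finsetSum]
  · simp_rw [integral_const_mul, integral_jacobiPoly_mul hα hβ]
    simp
  · exact fun κ' _ => integrable_jacobiMeasure_of_continuousOn hα hβ (by fun_prop)

/-- Spectral operators act diagonally. -/
theorem spectralOp_eq_sum (hα : ∀ i, -(1 / 2 : ℝ) < α i) (hβ : ∀ i, -(1 / 2 : ℝ) < β i)
    (Φ : ℝ → ℝ) (q : MvPolynomial (Fin d) ℝ) (s : Finset (Fin d → ℕ)) (c : (Fin d → ℕ) → ℝ)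
    (hq : ∀ x, MvPolynomial.eval x q = ∑ κ ∈ s, c κ * jacobiPoly α β κ x) (x : Fin d → ℝ) :
    spectralOp α β Φ q x = ∑ κ ∈ s, Φ (eigenvalue α β κ) * c κ * jacobiPoly α β κ x := by
  unfold spectralOp
  simp_rw [hq, jacobiCoeff_sum hα hβ]
  rw [tsum_eq_sum (s := s)]
  · exact Finset.sum_congr rfl fun κ hκ => by rw [if_pos hκ]
  · intro κ hκ
    rw [if_neg hκ, mul_zero, zero_mul]

theorem continuous_spectralOp (hα : ∀ i, -(1 / 2 : ℝ) < α i) (hβ : ∀ i, -(1 / 2 : ℝ) < β i)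
    (Φ : ℝ → ℝ) (q : MvPolynomial (Fin d) ℝ) : Continuous (spectralOp α β Φ q) := by
  obtain ⟨c, hc⟩ := exists_eval_eq_sum_jacobiPoly hα hβ q
  rw [funext (spectralOp_eq_sum hα hβ Φ q c.support c hc)]
  fun_prop

theorem jacobiCoeff_spectralOp (hα : ∀ i, -(1 / 2 : ℝ) < α i) (hβ : ∀ i, -(1 / 2 : ℝ) < β i)
    (Φ : ℝ → ℝ) (q : MvPolynomial (Fin d) ℝ) (κ : Fin d → ℕ) :
    jacobiCoeff α β (spectralOp α β Φ q) κ =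
      Φ (eigenvalue α β κ) * jacobiCoeff α β (fun x => MvPolynomial.eval x q) κ := by
  obtain ⟨c, hc⟩ := exists_eval_eq_sum_jacobiPoly hα hβ q
  rw [funext (spectralOp_eq_sum hα hβ Φ q c.support c hc), funext hc, jacobiCoeff_sum hα hβ,
    jacobiCoeff_sum hα hβ]
  split_ifs <;> simp

/-- Stone–Weierstrass: the coordinate functions separate points. -/
theorem exists_mvPolynomial_near_continuous {g : (Fin d → ℝ) → ℝ} (hg : Continuous g) {ε : ℝ}
    (hε : 0 < ε) : ∃ q : MvPolynomial (Fin d) ℝ, ∀ x ∈ Icc (-1 : Fin d → ℝ) 1,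
      |MvPolynomial.eval x q - g x| < ε := by
  set φ := MvPolynomial.aeval (R := ℝ)
    (fun i => (⟨fun x => x i, continuous_apply i⟩ : C(Fin d → ℝ, ℝ))) with hφ
  have hev : ∀ q x, φ q x = MvPolynomial.eval x q := by
    intro q x
    induction q using MvPolynomial.induction_on with
    | C a => simp [hφ]
    | add p q hp hq => simp [hp, hq]
    | mul_X p i hp => rw [map_mul, ContinuousMap.mul_apply, hp, map_mul, MvPolynomial.eval_X, hφ,
        MvPolynomial.aeval_X]; rfl
  have hsep : φ.range.SeparatesPoints := by
    intro x y hxy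
    obtain ⟨i, hi⟩ := Function.ne_iff.mp hxy
    refine ⟨fun x => x i, ⟨φ (MvPolynomial.X i), ⟨_, rfl⟩, ?_⟩, hi⟩
    ext z
    exact (hev _ z).trans (MvPolynomial.eval_X i)
  obtain ⟨_, ⟨q, rfl⟩, hq⟩ :=
    ContinuousMap.exists_mem_subalgebra_near_continuous_of_isCompact_of_separatesPoints hsep
      ⟨g, hg⟩ (isCompact_Icc (a := (-1 : Fin d → ℝ)) (b := 1)) hε
  refine ⟨q, fun x hx => ?_⟩
  have := hq x hx
  rw [← hev]
  exact this

/-- An integrable function is determined by its Jacobi coefficients. -/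
theorem ae_eq_zero_of_jacobiCoeff_eq_zero (hα : ∀ i, -(1 / 2 : ℝ) < α i)
    (hβ : ∀ i, -(1 / 2 : ℝ) < β i) {h : (Fin d → ℝ) → ℝ} (hh : Integrable h (jacobiMeasure α β))
    (h0 : ∀ κ, jacobiCoeff α β h κ = 0) : ∀ᵐ x ∂jacobiMeasure α β, h x = 0 := by
  refine ae_eq_zero_of_integral_contDiff_smul_eq_zero hh.locallyIntegrable fun g hg _ => ?_
  have hpoly : ∀ q : MvPolynomial (Fin d) ℝ,
      ∫ x, h x * MvPolynomial.eval x q ∂jacobiMeasure α β = 0 := by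
    intro q
    obtain ⟨c, hc⟩ := exists_eval_eq_sum_jacobiPoly hα hβ q
    simp_rw [hc, Finset.mul_sum, mul_left_comm (h _)]
    rw [integral_finsetSum]
    · refine Finset.sum_eq_zero fun κ _ => ?_
      rw [integral_const_mul]
      exact mul_eq_zero_of_right _ (h0 κ)
    · exact fun κ _ => (integrable_mul_jacobiMeasure_of_continuousOn hα hβ
        (continuous_jacobiPoly α β κ).continuousOn hh).const_mul _
  -- The integral `I` of `h` against the test function is unchanged when a polynomial is subtracted
  -- from the test function. Uniform approximation to within `|I| / (N + 1)`, with `N = ‖h‖₁`, then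
  -- gives `|I| ≤ |I| N / (N + 1) < |I|`.
  by_contra hne
  set I := ∫ x, g x • h x ∂jacobiMeasure α β with hI
  set N := ∫ x, |h x| ∂jacobiMeasure α β
  have hN : 0 ≤ N := integral_nonneg fun x => abs_nonneg _
  have hIpos : 0 < |I| := abs_pos.mpr hne
  obtain ⟨q, hq⟩ := exists_mvPolynomial_near_continuous hg.continuous
    (ε := |I| / (N + 1)) (by positivity)
  have i1 := integrable_mul_jacobiMeasure_of_continuousOn hα hβ hg.continuous.continuousOn hh
  have i2 := integrable_mul_jacobiMeasure_of_continuousOn hα hβ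
    (MvPolynomial.continuous_eval q).continuousOn hh
  have e : I = ∫ x, (h x * g x - h x * MvPolynomial.eval x q) ∂jacobiMeasure α β := by
    rw [integral_sub i1 i2, hpoly, sub_zero, hI]
    simp only [smul_eq_mul, mul_comm]
  have : |I| ≤ |I| / (N + 1) * N := by
    conv_lhs => rw [e]
    rw [← integral_const_mul, ← Real.norm_eq_abs]
    refine norm_integral_le_of_norm_le (hh.abs.const_mul _) ?_
    filter_upwards [ae_mem_Icc_jacobiMeasure hα hβ] with x hx
    rw [← mul_sub, Real.norm_eq_abs, abs_mul, mul_comm, abs_sub_comm]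
    exact mul_le_mul_of_nonneg_right (hq x hx).le (abs_nonneg _)
  have h2 : |I| / (N + 1) * N < |I| := by
    rw [div_mul_eq_mul_div, div_lt_iff₀ (by positivity)]
    nlinarith
  linarith

theorem ae_eq_of_jacobiCoeff_eq (hα : ∀ i, -(1 / 2 : ℝ) < α i)
    (hβ : ∀ i, -(1 / 2 : ℝ) < β i) {g h : (Fin d → ℝ) → ℝ} (hg : Integrable g (jacobiMeasure α β))
    (hh : Integrable h (jacobiMeasure α β))
    (h0 : ∀ κ, jacobiCoeff α β g κ = jacobiCoeff α β h κ) : g =ᵐ[jacobiMeasure α β] h := by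
  have := ae_eq_zero_of_jacobiCoeff_eq_zero hα hβ (hg.sub hh) fun κ => by
    have := h0 κ
    unfold jacobiCoeff at this ⊢
    simp_rw [Pi.sub_apply, sub_mul]
    rw [integral_sub, this, sub_self]
    · exact integrable_mul_jacobiMeasure_of_continuousOn hα hβ (by fun_prop) hg
    · exact integrable_mul_jacobiMeasure_of_continuousOn hα hβ (by fun_prop) hh
  exact this.mono fun x hx => sub_eq_zero.mp hx

end Cube

/-! ### The Jacobi operator on `C²` functions of the cube -/

section Operator

variable {d : ℕ} {α β : Fin d → ℝ}

theorem update_mem_cube {z : Fin d → ℝ} (hz : z ∈ Icc (-1 : Fin d → ℝ) 1) (i : Fin d) {s : ℝ}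
    (hs : s ∈ Icc (-1 : ℝ) 1) : Function.update z i s ∈ Icc (-1 : Fin d → ℝ) 1 := by
  constructor <;> intro j <;> rcases eq_or_ne j i with rfl | h
  · simpa using hs.1
  · simpa [h] using hz.1 j
  · simpa using hs.2
  · simpa [h] using hz.2 j

/-- Functions on the cube whose integrals over all lines in a coordinate direction agree have
the same integral. -/
theorem integral_jacobiMeasure_eq_of_slices (hα : ∀ i, -(1 / 2 : ℝ) < α i)
    (hβ : ∀ i, -(1 / 2 : ℝ) < β i) (i : Fin d) {F G : (Fin d → ℝ) → ℝ}
    (hF : Integrable F (jacobiMeasure α β)) (hG : Integrable G (jacobiMeasure α β))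
    (h : ∀ z ∈ Icc (-1 : Fin d → ℝ) 1,
      ∫ s, F (Function.update z i s) ∂jacobiMeasureOne (α i) (β i) =
        ∫ s, G (Function.update z i s) ∂jacobiMeasureOne (α i) (β i)) :
    ∫ x, F x ∂jacobiMeasure α β = ∫ x, G x ∂jacobiMeasure α β := by
  cases d with
  | zero => exact i.elim0
  | succ n =>
    have hfin := fun i => isFiniteMeasure_jacobiMeasureOne (a := α i) (b := β i)
      (by linarith [hα i]) (by linarith [hβ i])
    have mp := (measurePreserving_piFinSuccAbove
      (fun i => jacobiMeasureOne (α i) (β i)) i).symm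
    have key : ∀ H : (Fin (n + 1) → ℝ) → ℝ, Integrable H (jacobiMeasure α β) →
        ∫ x, H x ∂jacobiMeasure α β = ∫ y, ∫ s, H (Function.update (i.insertNth 0 y) i s)
          ∂jacobiMeasureOne (α i) (β i)
          ∂jacobiMeasure (fun j => α (i.succAbove j)) (fun j => β (i.succAbove j)) := by
      intro H hH
      have e1 : ∫ x, H x ∂jacobiMeasure α β = _ := (mp.integral_comp' H).symm
      have hi := (mp.integrable_comp_emb (MeasurableEquiv.measurableEmbedding _)).mpr hH
      rw [e1]
      refine (integral_prod_symm _ hi).trans ?_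
      refine integral_congr_ae (ae_of_all _ fun y => integral_congr_ae (ae_of_all _ fun s => ?_))
      simp only [Fin.update_insertNth]
      rfl
    rw [key F hF, key G hG]
    refine integral_congr_ae ?_
    filter_upwards [ae_mem_Icc_jacobiMeasure (fun j => hα (i.succAbove j))
      (fun j => hβ (i.succAbove j))] with y hy
    refine h _ ⟨fun j => ?_, fun j => ?_⟩
    · rcases i.eq_self_or_eq_succAbove j with rfl | ⟨k, rfl⟩
      · simp
      · simpa using hy.1 k
    · rcases i.eq_self_or_eq_succAbove j with rfl | ⟨k, rfl⟩
      · simp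
      · simpa using hy.2 k

theorem uniqueDiffOn_cube : UniqueDiffOn ℝ (Icc (-1 : Fin d → ℝ) 1) := by
  rw [← pi_univ_Icc]
  exact UniqueDiffOn.univ_pi fun i => uniqueDiffOn_Icc (by simp)

theorem hasDerivAt_slice {g : (Fin d → ℝ) → ℝ} (hg : DifferentiableOn ℝ g (Icc (-1) 1))
    {z : Fin d → ℝ} (hz : z ∈ Icc (-1 : Fin d → ℝ) 1) (i : Fin d) {s : ℝ}
    (hs : s ∈ Ioo (-1 : ℝ) 1) :
    HasDerivAt (fun s => g (Function.update z i s))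
      (fderivWithin ℝ g (Icc (-1) 1) (Function.update z i s) (Pi.single i 1)) s := by
  have h1 := (hg _ (update_mem_cube hz i ⟨hs.1.le, hs.2.le⟩)).hasFDerivWithinAt
  have h2 := (hasDerivAt_update z i s).hasDerivWithinAt (s := Icc (-1) 1)
  exact (h1.comp_hasDerivWithinAt s h2 fun t ht => update_mem_cube hz i ht).hasDerivAt
    (Icc_mem_nhds hs.1 hs.2)

theorem jacobiPoly_update (κ : Fin d → ℕ) (z : Fin d → ℝ) (i : Fin d) (s : ℝ) :
    jacobiPoly α β κ (Function.update z i s) = jacobiPolyOne (α i) (β i) (κ i) s *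
      ∏ j ∈ Finset.univ.erase i, jacobiPolyOne (α j) (β j) (κ j) (z j) := by
  rw [jacobiPoly, ← Finset.mul_prod_erase _ _ (Finset.mem_univ i), Function.update_self]
  congr 1
  exact Finset.prod_congr rfl fun j hj => by rw [Function.update_of_ne (Finset.ne_of_mem_erase hj)]

/-- On each line parallel to the `i`-th axis the other factors of `p_κ` are constant, and the
one-dimensional identity applies. Derivatives are taken within the closed cube, so that they are
continuous up to the boundary. -/
theorem exists_jacobiOperator_coord (hα : ∀ i, -(1 / 2 : ℝ) < α i) (hβ : ∀ i, -(1 / 2 : ℝ) < β i)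
    {f : (Fin d → ℝ) → ℝ} (hf : ContDiffOn ℝ 2 f (Icc (-1) 1)) (i : Fin d) :
    ∃ g : (Fin d → ℝ) → ℝ, ContinuousOn g (Icc (-1) 1) ∧ ∀ κ, jacobiCoeff α β g κ =
      -(κ i * (κ i + α i + β i + 1)) * jacobiCoeff α β f κ := by
  set C := Icc (-1 : Fin d → ℝ) 1 with hC
  set f₁ : (Fin d → ℝ) → ℝ := fun x => fderivWithin ℝ f C x (Pi.single i 1) with hf₁
  set f₂ : (Fin d → ℝ) → ℝ := fun x => fderivWithin ℝ f₁ C x (Pi.single i 1) with hf₂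
  have c1 : ContDiffOn ℝ 1 f₁ C :=
    (hf.fderivWithin uniqueDiffOn_cube (m := 1) (by norm_num)).clm_apply contDiffOn_const
  have c2 : ContinuousOn f₂ C :=
    (c1.continuousOn_fderivWithin uniqueDiffOn_cube le_rfl).clm_apply continuousOn_const
  set g : (Fin d → ℝ) → ℝ := fun x =>
    (1 - x i ^ 2) * f₂ x + (β i - α i - (α i + β i + 2) * x i) * f₁ x with hg
  have cf := hf.continuousOn
  have cf₁ := c1.continuousOn
  have cg : ContinuousOn g C := by fun_prop
  refine ⟨g, cg, fun κ => ?_⟩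
  unfold jacobiCoeff
  rw [← integral_const_mul]
  refine integral_jacobiMeasure_eq_of_slices hα hβ i
    (integrable_jacobiMeasure_of_continuousOn hα hβ (by fun_prop))
    (integrable_jacobiMeasure_of_continuousOn hα hβ (by fun_prop)) fun z hz => ?_
  have cu : ContinuousOn (fun s => Function.update z i s) (Icc (-1 : ℝ) 1) :=
    (Continuous.update (f := fun _ : ℝ => z) continuous_const i continuous_id).continuousOn
  have mu : MapsTo (fun s => Function.update z i s) (Icc (-1 : ℝ) 1) C :=
    fun s hs => update_mem_cube hz i hs
  have key := integral_jacobiOperator_mul_jacobiP (a := α i) (b := β i) (by linarith [hα i])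
    (by linarith [hβ i]) (κ i) (cf.comp cu mu) (cf₁.comp cu mu) (c2.comp cu mu)
    (fun s hs => hasDerivAt_slice (hf.differentiableOn (by norm_num)) hz i hs)
    (fun s hs => hasDerivAt_slice (c1.differentiableOn (by norm_num)) hz i hs)
  set K := (∏ j ∈ Finset.univ.erase i, jacobiPolyOne (α j) (β j) (κ j) (z j)) /
    √(∫ y, jacobiP (α i) (β i) (κ i) y ^ 2 ∂jacobiMeasureOne (α i) (β i)) with hK
  have hp : ∀ s, jacobiPoly α β κ (Function.update z i s) = jacobiP (α i) (β i) (κ i) s * K := by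
    intro s
    rw [jacobiPoly_update, jacobiPolyOne, hK]
    ring
  simp only [hp, hg, Function.update_self, ← mul_assoc, integral_mul_const]
  simp only [mul_assoc, integral_const_mul]
  simp only [Function.comp_apply] at key
  rw [key]
  ring

/-- The Jacobi operator of a `C²` function is continuous and acts diagonally. -/
theorem exists_jacobiOperator (hα : ∀ i, -(1 / 2 : ℝ) < α i) (hβ : ∀ i, -(1 / 2 : ℝ) < β i)
    {f : (Fin d → ℝ) → ℝ} (hf : ContDiffOn ℝ 2 f (Icc (-1) 1)) :
    ∃ g : (Fin d → ℝ) → ℝ, ContinuousOn g (Icc (-1) 1) ∧ ∀ κ, jacobiCoeff α β g κ =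
      -eigenvalue α β κ * jacobiCoeff α β f κ := by
  choose g hg hc using exists_jacobiOperator_coord hα hβ hf
  refine ⟨fun x => ∑ i, g i x, continuousOn_finsetSum _ fun i _ => hg i, fun κ => ?_⟩
  rw [eigenvalue, ← Finset.sum_neg_distrib, Finset.sum_mul]
  simp_rw [← hc]
  unfold jacobiCoeff
  simp_rw [Finset.sum_mul]
  refine integral_finsetSum _ fun i _ => ?_
  have := hg i
  exact integrable_jacobiMeasure_of_continuousOn hα hβ (by fun_prop)

end Operator

/-! ### Two integrals over the half-line -/

/-- The primitives used below have junk values at `0`, so only the right limit there is assumed and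
`g` is redefined at `0` by it. -/
theorem integrableOn_Ioi_of_hasDerivAt_of_nonneg_of_tendsto {g g' : ℝ → ℝ} {l m : ℝ}
    (hd : ∀ x ∈ Ioi (0 : ℝ), HasDerivAt g (g' x) x) (hpos : ∀ x ∈ Ioi (0 : ℝ), 0 ≤ g' x)
    (h0 : Tendsto g (𝓝[>] 0) (𝓝 l)) (h1 : Tendsto g atTop (𝓝 m)) :
    IntegrableOn g' (Ioi 0) := by
  refine integrableOn_Ioi_deriv_of_nonneg (g := Function.update g 0 l) (l := m)
    ?_ (fun x hx => ?_) hpos ?_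
  · rw [continuousWithinAt_update_same, Ici_sdiff_left]
    exact h0
  · exact (hd x hx).congr_of_eventuallyEq ((eventually_ne_nhds (ne_of_gt hx)).mono
      fun y hy => Function.update_of_ne hy _ _)
  · exact h1.congr' ((eventually_gt_atTop 0).mono
      fun y hy => (Function.update_of_ne (ne_of_gt hy) _ _).symm)

theorem integral_Ioi_of_hasDerivAt_of_tendsto_of_tendsto {g g' : ℝ → ℝ} {l m : ℝ}
    (hd : ∀ x ∈ Ioi (0 : ℝ), HasDerivAt g (g' x) x) (hi : IntegrableOn g' (Ioi 0))
    (h0 : Tendsto g (𝓝[>] 0) (𝓝 l)) (h1 : Tendsto g atTop (𝓝 m)) :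
    ∫ x in Ioi 0, g' x = m - l := by
  have := integral_Ioi_of_hasDerivAt_of_tendsto (f := Function.update g 0 l) (m := m) (a := 0)
    (f' := g') ?_ (fun x hx => ?_) hi ?_
  · simpa using this
  · rw [continuousWithinAt_update_same, Ici_sdiff_left]
    exact h0
  · exact (hd x hx).congr_of_eventuallyEq ((eventually_ne_nhds (ne_of_gt hx)).mono
      fun y hy => Function.update_of_ne hy _ _)
  · exact h1.congr' ((eventually_gt_atTop 0).mono
      fun y hy => (Function.update_of_ne (ne_of_gt hy) _ _).symm)

/-- The error function, up to normalization. -/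
def gaussPrimitive (w : ℝ) : ℝ := ∫ x in (0 : ℝ)..w, Real.exp (-x ^ 2)

theorem hasDerivAt_gaussPrimitive (w : ℝ) :
    HasDerivAt gaussPrimitive (Real.exp (-w ^ 2)) w :=
  (Continuous.integral_hasStrictDerivAt (by fun_prop) 0 w).hasDerivAt

theorem tendsto_gaussPrimitive_atTop :
    Tendsto gaussPrimitive atTop (𝓝 (√Real.pi / 2)) := by
  have h := integral_gaussian_Ioi 1
  have hi : Integrable fun x : ℝ => Real.exp (-1 * x ^ 2) := integrable_exp_neg_mul_sq one_pos
  simp only [neg_one_mul, div_one] at h hi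
  rw [← h]
  exact intervalIntegral_tendsto_integral_Ioi 0 hi.integrableOn tendsto_id

theorem gaussPrimitive_neg (w : ℝ) : gaussPrimitive (-w) = -gaussPrimitive w := by
  have := intervalIntegral.integral_comp_neg (a := 0) (b := w) fun x => Real.exp (-x ^ 2)
  simp only [neg_sq, neg_zero] at this
  rw [gaussPrimitive, gaussPrimitive, this, intervalIntegral.integral_symm]

theorem tendsto_gaussPrimitive_atBot :
    Tendsto gaussPrimitive atBot (𝓝 (-(√Real.pi / 2))) := by
  have := (tendsto_gaussPrimitive_atTop.comp tendsto_neg_atBot_atTop).neg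
  refine this.congr fun w => ?_
  rw [Function.comp_apply, gaussPrimitive_neg, neg_neg]

/-- Bochner's subordination formula, with integrability. -/
theorem subordination {b : ℝ} (hb : 0 ≤ b) :
    IntegrableOn (fun u : ℝ => Real.exp (-u) / √u * Real.exp (-(b ^ 2 / u))) (Ioi 0) ∧
    ∫ u in Ioi (0 : ℝ), Real.exp (-u) / √u * Real.exp (-(b ^ 2 / u)) =
      √Real.pi * Real.exp (-(2 * b)) := by
  -- Completing the square in two ways, `u + b²/u = (√u ∓ b/√u)² ± 2b`, yields an explicit
  -- primitive: the terms in `b u^(-3/2)` cancel in the derivative, and the parts with `exp(2b)`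
  -- cancel between the two limits.
  set A : ℝ → ℝ := fun u => Real.exp (-(2 * b)) * gaussPrimitive (√u - b / √u) +
    Real.exp (2 * b) * gaussPrimitive (√u + b / √u) with hA
  have hd : ∀ u ∈ Ioi (0 : ℝ),
      HasDerivAt A (Real.exp (-u) / √u * Real.exp (-(b ^ 2 / u))) u := by
    intro u hu
    have hu0 : (0 : ℝ) < u := hu
    have hs : 0 < √u := Real.sqrt_pos.mpr hu0
    have d1 := Real.hasDerivAt_sqrt hu0.ne'
    have d2 := (hasDerivAt_const u b).div d1 hs.ne'
    have d3 := ((hasDerivAt_gaussPrimitive (√u - b / √u)).comp u (d1.sub d2)).const_mul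
      (Real.exp (-(2 * b)))
    have d4 := ((hasDerivAt_gaussPrimitive (√u + b / √u)).comp u (d1.add d2)).const_mul
      (Real.exp (2 * b))
    refine (d3.add d4).congr_deriv ?_
    have e0 : √u ^ 2 = u := Real.sq_sqrt hu0.le
    have e1 : Real.exp (-(2 * b)) * Real.exp (-(√u - b / √u) ^ 2) =
        Real.exp (-u) * Real.exp (-(b ^ 2 / u)) := by
      rw [← Real.exp_add, ← Real.exp_add]
      congr 1
      field_simp
      simp only [e0]
      ring_nf
    have e2 : Real.exp (2 * b) * Real.exp (-(√u + b / √u) ^ 2) =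
        Real.exp (-u) * Real.exp (-(b ^ 2 / u)) := by
      rw [← Real.exp_add, ← Real.exp_add]
      congr 1
      field_simp
      simp only [e0]
      ring_nf
    rw [← mul_assoc, ← mul_assoc, e1, e2]
    field_simp
    ring
  have hinv : Tendsto (fun u : ℝ => b / √u) atTop (𝓝 0) :=
    tendsto_const_nhds.div_atTop Real.tendsto_sqrt_atTop
  have h1 : Tendsto A atTop (𝓝 (Real.exp (-(2 * b)) * (√Real.pi / 2) +
      Real.exp (2 * b) * (√Real.pi / 2))) := by
    have t1 : Tendsto (fun u : ℝ => √u - b / √u) atTop atTop := by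
      simpa only [sub_eq_add_neg] using Real.tendsto_sqrt_atTop.atTop_add hinv.neg
    have t2 : Tendsto (fun u : ℝ => √u + b / √u) atTop atTop :=
      Real.tendsto_sqrt_atTop.atTop_add hinv
    exact ((tendsto_gaussPrimitive_atTop.comp t1).const_mul _).add
      ((tendsto_gaussPrimitive_atTop.comp t2).const_mul _)
  have h0 : Tendsto A (𝓝[>] 0) (𝓝 (-(Real.exp (-(2 * b)) * (√Real.pi / 2)) +
      Real.exp (2 * b) * (√Real.pi / 2))) := by
    have hsq : Tendsto (fun u : ℝ => √u) (𝓝[>] 0) (𝓝[>] 0) := by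
      refine tendsto_nhdsWithin_iff.mpr ⟨?_, ?_⟩
      · have := (Real.continuous_sqrt.tendsto 0).mono_left (nhdsWithin_le_nhds (s := Ioi (0 : ℝ)))
        rwa [Real.sqrt_zero] at this
      · exact eventually_mem_nhdsWithin.mono fun u hu => Real.sqrt_pos.mpr hu
    have hsq0 : Tendsto (fun u : ℝ => √u) (𝓝[>] 0) (𝓝 0) := hsq.mono_right nhdsWithin_le_nhds
    -- For `b > 0` the arguments tend to `∓∞` at `0`; for `b = 0` they tend to `0`. The limit has
    -- the same formula in both cases.
    rcases hb.eq_or_lt with rfl | hb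
    · have t : Tendsto (fun u : ℝ => gaussPrimitive (√u)) (𝓝[>] 0) (𝓝 0) := by
        have := ((hasDerivAt_gaussPrimitive 0).continuousAt.tendsto).comp hsq0
        simpa [gaussPrimitive, Function.comp_def] using this
      simpa [hA] using t.add t
    · have hbs : Tendsto (fun u : ℝ => b / √u) (𝓝[>] 0) atTop := by
        simpa only [div_eq_mul_inv, Function.comp_def] using
          (tendsto_inv_nhdsGT_zero.comp hsq).const_mul_atTop hb
      have t1 : Tendsto (fun u : ℝ => √u - b / √u) (𝓝[>] 0) atBot := by
        simpa only [sub_eq_add_neg, Function.comp_def] using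
          hsq0.add_atBot (tendsto_neg_atTop_atBot.comp hbs)
      have t2 : Tendsto (fun u : ℝ => √u + b / √u) (𝓝[>] 0) atTop := hsq0.add_atTop hbs
      simpa only [mul_neg, hA, Function.comp_def] using ((tendsto_gaussPrimitive_atBot.comp t1).const_mul _).add
        ((tendsto_gaussPrimitive_atTop.comp t2).const_mul _)
  have hi := integrableOn_Ioi_of_hasDerivAt_of_nonneg_of_tendsto hd
    (fun u _ => by positivity) h0 h1
  refine ⟨hi, ?_⟩
  rw [integral_Ioi_of_hasDerivAt_of_tendsto_of_tendsto hd hi h0 h1]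
  ring

/-- Integration by parts with `s^(-γ) (exp(-s) - 1)`. The bound `|exp(-s) - 1| ≤ min s 1` gives
convergence and kills the boundary terms: `s` near `0` (needs `γ < 1`), `1` at infinity (needs `γ >
0`). -/
theorem cConst_eq {γ : ℝ} (h0 : 0 < γ) (h1 : γ < 1) :
    cConst γ = -(Real.Gamma (1 - γ) / γ) := by
  have hG : IntegrableOn (fun s : ℝ => Real.exp (-s) * s ^ (1 - γ - 1)) (Ioi 0) :=
    Real.GammaIntegral_convergent (by linarith)
  have e0 : 1 - γ - 1 = -γ := by ring
  rw [e0] at hG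
  have hpow : ∀ s : ℝ, 0 < s → s ^ (-γ) = s ^ (-γ - 1) * s := fun s hs => by
    rw [Real.rpow_sub_one hs.ne', div_mul_cancel₀ _ hs.ne']
  have hexp : ∀ s : ℝ, 0 < s → |Real.exp (-s) - 1| ≤ min s 1 := by
    intro s hs
    have a1 := Real.add_one_le_exp (-s)
    have a2 : Real.exp (-s) ≤ 1 := Real.exp_le_one_iff.mpr (by linarith)
    have a3 := Real.exp_pos (-s)
    rw [abs_of_nonpos (by linarith)]
    exact le_min (by linarith) (by linarith)
  have hc : IntegrableOn (fun s : ℝ => s ^ (-γ - 1) * (Real.exp (-s) - 1)) (Ioi 0) := by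
    rw [← Ioc_union_Ioi_eq_Ioi zero_le_one]
    have hm : Measurable fun s : ℝ => s ^ (-γ - 1) * (Real.exp (-s) - 1) := by fun_prop
    refine IntegrableOn.union ?_ ?_
    · have := intervalIntegral.intervalIntegrable_rpow' (a := 0) (b := 1) (r := -γ) (by linarith)
      rw [intervalIntegrable_iff_integrableOn_Ioc_of_le zero_le_one] at this
      refine Integrable.mono' this hm.aestronglyMeasurable ?_
      refine (ae_restrict_iff' measurableSet_Ioc).mpr (ae_of_all _ fun s hs => ?_)
      have p := Real.rpow_nonneg hs.1.le (-γ - 1)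
      rw [Real.norm_eq_abs, abs_mul, abs_of_nonneg p, hpow s hs.1]
      exact mul_le_mul_of_nonneg_left ((hexp s hs.1).trans (min_le_left _ _)) p
    · refine Integrable.mono' (integrableOn_Ioi_rpow_of_lt (a := -γ - 1) (by linarith) one_pos)
        hm.aestronglyMeasurable ?_
      refine (ae_restrict_iff' measurableSet_Ioi).mpr (ae_of_all _ fun s hs => ?_)
      have hs0 : (0 : ℝ) < s := one_pos.trans hs
      have p := Real.rpow_nonneg hs0.le (-γ - 1)
      rw [Real.norm_eq_abs, abs_mul, abs_of_nonneg p]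
      exact mul_le_of_le_one_right p ((hexp s hs0).trans (min_le_right _ _))
  have hd : ∀ s ∈ Ioi (0 : ℝ), HasDerivAt (fun s => s ^ (-γ) * (Real.exp (-s) - 1))
      (-γ * (s ^ (-γ - 1) * (Real.exp (-s) - 1)) - Real.exp (-s) * s ^ (-γ)) s := by
    intro s hs
    have d1 := Real.hasDerivAt_rpow_const (x := s) (p := -γ) (Or.inl (ne_of_gt hs))
    have d2 := ((hasDerivAt_neg s).exp.sub_const 1)
    refine (d1.mul d2).congr_deriv ?_
    ring
  have t0 : Tendsto (fun s : ℝ => s ^ (-γ) * (Real.exp (-s) - 1)) (𝓝[>] 0) (𝓝 0) := by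
    have t : Tendsto (fun s : ℝ => s ^ (1 - γ)) (𝓝[>] 0) (𝓝 0) := by
      have := (Real.continuousAt_rpow_const 0 (1 - γ) (Or.inr (by linarith))).tendsto
      rw [Real.zero_rpow (by linarith)] at this
      exact this.mono_left nhdsWithin_le_nhds
    refine squeeze_zero_norm' (eventually_mem_nhdsWithin.mono fun s hs => ?_) t
    have hs0 : (0 : ℝ) < s := hs
    have p := Real.rpow_nonneg hs0.le (-γ)
    rw [Real.norm_eq_abs, abs_mul, abs_of_nonneg p, show 1 - γ = -γ + 1 by ring,
      Real.rpow_add_one hs0.ne']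
    exact mul_le_mul_of_nonneg_left ((hexp s hs0).trans (min_le_left _ _)) p
  have t1 : Tendsto (fun s : ℝ => s ^ (-γ) * (Real.exp (-s) - 1)) atTop (𝓝 0) := by
    refine squeeze_zero_norm' ((eventually_gt_atTop 0).mono fun s hs => ?_)
      (tendsto_rpow_neg_atTop h0)
    have p := Real.rpow_nonneg hs.le (-γ)
    rw [Real.norm_eq_abs, abs_mul, abs_of_nonneg p]
    exact mul_le_of_le_one_right p ((hexp s hs).trans (min_le_right _ _))
  have key := integral_Ioi_of_hasDerivAt_of_tendsto_of_tendsto hd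
    ((hc.const_mul (-γ)).sub hG) t0 t1
  rw [integral_sub (hc.const_mul (-γ)) hG, integral_const_mul] at key
  have hΓ : Real.Gamma (1 - γ) = ∫ s in Ioi (0 : ℝ), Real.exp (-s) * s ^ (-γ) := by
    rw [Real.Gamma_eq_integral (by linarith), e0]
  rw [hΓ, cConst]
  field_simp
  linarith

/-! ### Subordinated series -/

section Series

variable {ι : Type*} {r a c : ι → ℝ}

/-- Half of the exponential absorbs the factor `s`, so summability for all `t` survives a
differentiation in `t`. -/
theorem mul_exp_neg_le {s t : ℝ} (ht : 0 < t) : s * Real.exp (-(t * s)) ≤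
    2 / t * Real.exp (-(t / 2 * s)) := by
  have h1 : t / 2 * s ≤ Real.exp (t / 2 * s) := by linarith [Real.add_one_le_exp (t / 2 * s)]
  have h2 : Real.exp (-(t * s)) = Real.exp (-(t / 2 * s)) * Real.exp (-(t / 2 * s)) := by
    rw [← Real.exp_add]; ring_nf
  have h3 : Real.exp (t / 2 * s) * Real.exp (-(t / 2 * s)) = 1 := by
    rw [← Real.exp_add, add_neg_cancel, Real.exp_zero]
  have h4 := Real.exp_pos (-(t / 2 * s))
  calc s * Real.exp (-(t * s))
      = 2 / t * ((t / 2 * s) * Real.exp (-(t / 2 * s))) * Real.exp (-(t / 2 * s)) := by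
        rw [h2]; field_simp
    _ ≤ 2 / t * (Real.exp (t / 2 * s) * Real.exp (-(t / 2 * s))) * Real.exp (-(t / 2 * s)) := by
        gcongr
    _ = _ := by rw [h3, mul_one]

theorem summable_mul_mul_exp (hr : ∀ k, 0 ≤ r k)
    (ha : ∀ t : ℝ, 0 < t → Summable fun k => |a k| * Real.exp (-(t * r k))) {t : ℝ} (ht : 0 < t) :
    Summable fun k => |a k| * (r k * Real.exp (-(t * r k))) := by
  refine Summable.of_nonneg_of_le (fun k => ?_) (fun k => ?_) ((ha (t / 2) (by positivity)).mul_left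
    (2 / t))
  · have := hr k
    positivity
  · rw [mul_left_comm (2 / t)]
    exact mul_le_mul_of_nonneg_left (mul_exp_neg_le ht) (abs_nonneg _)

theorem hasDerivAt_tsum_mul_exp (hr : ∀ k, 0 ≤ r k)
    (ha : ∀ t : ℝ, 0 < t → Summable fun k => |a k| * Real.exp (-(t * r k))) {t : ℝ} (ht : 0 < t) :
    HasDerivAt (fun t => ∑' k, a k * Real.exp (-(t * r k)))
      (∑' k, a k * (-r k * Real.exp (-(t * r k)))) t := by
  have ht2 : 0 < t / 2 := by positivity
  -- On `(t/2, ∞)` the differentiated terms are dominated by their values at `t/2`.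
  refine hasDerivAt_tsum_of_isPreconnected (t := Ioi (t / 2)) (y₀ := t) (y := t)
    (g := fun k t => a k * Real.exp (-(t * r k)))
    (g' := fun k t => a k * (-r k * Real.exp (-(t * r k)))) (summable_mul_mul_exp hr ha ht2)
    isOpen_Ioi isPreconnected_Ioi (fun k s _ => ?_) (fun k s hs => ?_) ?_ ?_ ?_
  · have h1 : HasDerivAt (fun s : ℝ => -(s * r k)) (-r k) s :=
      (hasDerivAt_mul_const (r k)).neg
    refine (h1.exp.const_mul (a k)).congr_deriv ?_
    ring
  · rw [Real.norm_eq_abs, abs_mul, neg_mul, abs_neg, abs_mul, abs_of_nonneg (hr k),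
      abs_of_pos (Real.exp_pos _)]
    have hs' : t / 2 < s := hs
    have := hr k
    gcongr
  · exact half_lt_self ht
  · refine Summable.of_norm ((ha t ht).congr fun k => ?_)
    rw [Real.norm_eq_abs, abs_mul, abs_of_pos (Real.exp_pos _)]
  · exact half_lt_self ht

/-- Termwise subordination with `b = t r / 2`. The weight is nonnegative, so the norms integrate to
`√π |a| exp(-t r)`, which is summable by assumption, and sum and integral may be exchanged. -/
theorem integral_subordination_tsum [Countable ι] (hr : ∀ k, 0 ≤ r k)
    (ha : ∀ t : ℝ, 0 < t → Summable fun k => |a k| * Real.exp (-(t * r k))) {t : ℝ} (ht : 0 < t) :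
    1 / √Real.pi * ∫ u in Ioi (0 : ℝ),
      Real.exp (-u) / √u * ∑' k, Real.exp (-(r k ^ 2) * (t ^ 2 / (4 * u))) * a k =
    ∑' k, a k * Real.exp (-(t * r k)) := by
  have e : ∀ k u, Real.exp (-u) / √u * (Real.exp (-(r k ^ 2) * (t ^ 2 / (4 * u))) * a k) =
      a k * (Real.exp (-u) / √u * Real.exp (-((t * r k / 2) ^ 2 / u))) := by
    intro k u
    rw [show -(r k ^ 2) * (t ^ 2 / (4 * u)) = -((t * r k / 2) ^ 2 / u) by ring]
    ring
  have hsub := fun k => subordination (b := t * r k / 2) (by have := hr k; positivity)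
  have e2 : ∀ k, -(2 * (t * r k / 2)) = -(t * r k) := fun k => by ring
  simp_rw [← tsum_mul_left, e]
  have hπ : √Real.pi ≠ 0 := (Real.sqrt_pos.mpr Real.pi_pos).ne'
  rw [← (hasSum_integral_of_summable_integral_norm (fun k => (hsub k).1.const_mul (a k)) ?_).tsum_eq]
  · rw [← tsum_mul_left]
    refine tsum_congr fun k => ?_
    rw [integral_const_mul, (hsub k).2, e2]
    field_simp
  · refine ((ha t ht).mul_left (√Real.pi)).congr fun k => ?_
    have : ∀ u : ℝ, ‖a k * (Real.exp (-u) / √u * Real.exp (-((t * r k / 2) ^ 2 / u)))‖ =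
        |a k| * (Real.exp (-u) / √u * Real.exp (-((t * r k / 2) ^ 2 / u))) := by
      intro u
      rw [Real.norm_eq_abs, abs_mul, abs_of_nonneg (by positivity : 0 ≤ Real.exp (-u) / √u *
        Real.exp (-((t * r k / 2) ^ 2 / u)))]
    simp_rw [this]
    rw [integral_const_mul, (hsub k).2, e2]
    ring

theorem summable_coeff (hr : ∀ k, 0 ≤ r k) {M : ℝ} (hM : ∀ k, |c k| ≤ M)
    (hs : ∀ t : ℝ, 0 < t → Summable fun k => Real.exp (-(t * r k))) {t : ℝ} (ht : 0 < t) :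
    Summable fun k => |t * c k * (r k * Real.exp (-(t * r k)))| := by
  have h1 := summable_mul_mul_exp (a := fun _ => M) hr (fun t ht => (hs t ht).mul_left _) ht
  refine Summable.of_nonneg_of_le (fun k => abs_nonneg _) (fun k => ?_) (h1.mul_left t)
  have := hr k
  rw [mul_assoc, abs_mul, abs_mul, abs_of_pos ht, abs_of_nonneg (by positivity :
    0 ≤ r k * Real.exp (-(t * r k)))]
  exact mul_le_mul_of_nonneg_left (mul_le_mul_of_nonneg_right ((hM k).trans (le_abs_self M))
    (by positivity)) ht.le

theorem summable_mul_exp_of_bounded {M : ℝ} (hM : ∀ k, |c k| ≤ M)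
    (ha : ∀ t : ℝ, 0 < t → Summable fun k => |a k| * Real.exp (-(t * r k))) (t : ℝ) (ht : 0 < t) :
    Summable fun k => |c k * a k| * Real.exp (-(t * r k)) := by
  refine Summable.of_nonneg_of_le (fun k => by positivity) (fun k => ?_) ((ha t ht).mul_left M)
  rw [abs_mul, mul_assoc]
  exact mul_le_mul_of_nonneg_right (hM k) (by positivity)

theorem summable_coeff_mul (hr : ∀ k, 0 ≤ r k) {M : ℝ} (hM : ∀ k, |c k| ≤ M)
    (ha : ∀ t : ℝ, 0 < t → Summable fun k => |a k| * Real.exp (-(t * r k))) {t : ℝ} (ht : 0 < t) :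
    Summable fun k => ‖t * c k * (r k * Real.exp (-(t * r k))) * a k‖ := by
  refine Summable.of_nonneg_of_le (fun k => norm_nonneg _) (fun k => ?_)
    ((summable_mul_mul_exp hr ha ht).mul_left (M * t))
  have := hr k
  have h3 : |t * c k * (r k * Real.exp (-(t * r k))) * a k| =
      |c k| * (t * (|a k| * (r k * Real.exp (-(t * r k))))) := by
    rw [abs_mul, abs_mul, abs_mul, abs_of_pos ht,
      abs_of_nonneg (by positivity : 0 ≤ r k * Real.exp (-(t * r k)))]
    ring
  rw [Real.norm_eq_abs, h3, mul_assoc]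
  exact mul_le_mul_of_nonneg_right (hM k) (by positivity)

end Series

/-! ### Expansions in an orthonormal system -/

section Expansion

variable {X : Type*} [MeasurableSpace X] {μ : Measure X}
  {ι : Type*} [DecidableEq ι] {e : ι → X → ℝ} {r c : ι → ℝ}

theorem integrable_mul_of_memLp_two {f g : X → ℝ} (hf : MemLp f 2 μ) (hg : MemLp g 2 μ) :
    Integrable (fun x => f x * g x) μ :=
  hf.integrable_mul hg

theorem integral_abs_mul_le {f g : X → ℝ} (hf : MemLp f 2 μ) (hg : MemLp g 2 μ) :
    ∫ x, |f x * g x| ∂μ ≤ (∫ x, f x * f x ∂μ + ∫ x, g x * g x ∂μ) / 2 := by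
  rw [← integral_add (integrable_mul_of_memLp_two hf hf) (integrable_mul_of_memLp_two hg hg), ← integral_div]
  refine integral_mono (integrable_mul_of_memLp_two hf hg).abs
    (((integrable_mul_of_memLp_two hf hf).add (integrable_mul_of_memLp_two hg hg)).div_const 2) fun x => ?_
  rw [abs_le]
  constructor <;> nlinarith [sq_nonneg (f x - g x), sq_nonneg (f x + g x)]

/-- The inequality `|g| ≤ (g² + 1)/2` applied to the sum divided by `τ`, with orthonormality for the
square. The free scale `τ` is later set to `t exp(-t)`. -/
theorem integral_abs_sum_le [IsFiniteMeasure μ] (he : ∀ k, MemLp (e k) 2 μ)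
    (ho : ∀ k l, ∫ x, e k x * e l x ∂μ = if k = l then 1 else 0) (S : Finset ι) (b : ι → ℝ)
    {τ : ℝ} (hτ : 0 < τ) :
    ∫ x, |∑ k ∈ S, b k * e k x| ∂μ ≤ τ * (μ.real univ + ∑ k ∈ S, (b k / τ) ^ 2) / 2 := by
  have hg : MemLp (fun x => ∑ k ∈ S, (b k / τ) * e k x) 2 μ :=
    memLp_finsetSum _ fun k _ => (he k).const_mul _
  have h1 := integral_abs_mul_le hg (memLp_const (1 : ℝ) (μ := μ) (p := 2))
  have h2 : ∫ x, (∑ k ∈ S, (b k / τ) * e k x) * (∑ k ∈ S, (b k / τ) * e k x) ∂μ =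
      ∑ k ∈ S, (b k / τ) ^ 2 := by
    have hi : ∀ k l, Integrable (fun x => b k / τ * e k x * (b l / τ * e l x)) μ := fun k l =>
      ((he k).const_mul _).integrable_mul ((he l).const_mul _)
    simp_rw [Finset.sum_mul_sum]
    rw [integral_finsetSum _ fun k _ => integrable_finsetSum _ fun l _ => hi k l]
    refine Finset.sum_congr rfl fun k hk => ?_
    rw [integral_finsetSum _ fun l _ => hi k l]
    have hm : ∀ l x, b k / τ * e k x * (b l / τ * e l x) =
        (b k / τ * (b l / τ)) * (e k x * e l x) := fun l x => by ring
    simp_rw [hm, integral_const_mul, ho]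
    simp [hk, pow_two]
  have h3 : ∀ x, |∑ k ∈ S, b k * e k x| = τ * |∑ k ∈ S, (b k / τ) * e k x| := by
    intro x
    rw [← congrArg (· * _) (abs_of_pos hτ), ← abs_mul, Finset.mul_sum]
    congr 1
    refine Finset.sum_congr rfl fun k _ => ?_
    field_simp
  simp_rw [h3, integral_const_mul]
  rw [h2] at h1
  simp only [mul_one, integral_const, smul_eq_mul] at h1
  nlinarith

/-- The function `-t ∂ₜ` of the Poisson extension. -/
def poissonQSeries (e : ι → X → ℝ) (r c : ι → ℝ) (t : ℝ) (x : X) : ℝ :=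
  ∑' k, t * c k * (r k * Real.exp (-(t * r k))) * e k x

variable [Countable ι]

/-- The exchange is dominated because `∫ |f e_k|` is bounded uniformly in `k`. -/
theorem integral_mul_tsum_kernel (he : ∀ k, MemLp (e k) 2 μ)
    (ho : ∀ k l, ∫ x, e k x * e l x ∂μ = if k = l then 1 else 0) {f : X → ℝ} (hf : MemLp f 2 μ)
    {b : ι → ℝ} (hb : Summable fun k => |b k|) :
    ∫ y, f y * ∑' k, b k * e k y ∂μ = ∑' k, b k * ∫ y, f y * e k y ∂μ := by
  simp_rw [← tsum_mul_left, mul_left_comm (f _)]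
  rw [← (hasSum_integral_of_summable_integral_norm (μ := μ)
    (fun k => (integrable_mul_of_memLp_two hf (he k)).const_mul (b k)) ?_).tsum_eq]
  · simp_rw [integral_const_mul]
  · refine Summable.of_nonneg_of_le (fun k => integral_nonneg fun x => norm_nonneg _) (fun k => ?_)
      (hb.mul_right ((∫ x, f x * f x ∂μ + 1) / 2))
    simp_rw [norm_mul, Real.norm_eq_abs, integral_const_mul]
    refine mul_le_mul_of_nonneg_left ?_ (abs_nonneg _)
    have := integral_abs_mul_le hf (he k)
    simpa [ho] using this

/-- Coefficients of `poissonQSeries`. -/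
theorem integral_poissonQSeries_mul (he : ∀ k, MemLp (e k) 2 μ)
    (ho : ∀ k l, ∫ x, e k x * e l x ∂μ = if k = l then 1 else 0) (hr : ∀ k, 0 ≤ r k)
    {M : ℝ} (hM : ∀ k, |c k| ≤ M)
    (hs : ∀ t : ℝ, 0 < t → Summable fun k => Real.exp (-(t * r k))) {t : ℝ} (ht : 0 < t) (l : ι) :
    ∫ x, poissonQSeries e r c t x * e l x ∂μ = t * c l * (r l * Real.exp (-(t * r l))) := by
  simp_rw [mul_comm _ (e l _), poissonQSeries]
  rw [integral_mul_tsum_kernel he ho (he l) (summable_coeff hr hM hs ht), tsum_eq_single l]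
  · rw [ho, if_pos rfl, mul_one]
  · intro k hk
    rw [ho, if_neg hk.symm, mul_zero]

variable [IsFiniteMeasure μ]

/-- At almost every point the orthonormal system grows slower than every exponential of `r`. -/
theorem ae_summable_abs_mul_exp (he : ∀ k, MemLp (e k) 2 μ)
    (ho : ∀ k l, ∫ x, e k x * e l x ∂μ = if k = l then 1 else 0) (hr : ∀ k, 0 ≤ r k)
    (hs : ∀ t : ℝ, 0 < t → Summable fun k => Real.exp (-(t * r k))) :
    ∀ᵐ x ∂μ, ∀ t : ℝ, 0 < t → Summable fun k => |e k x| * Real.exp (-(t * r k)) := by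
  -- The times `1/(n+1)` suffice, since the terms decrease in `t`; a single null set then serves all
  -- `t > 0`. For each `n` the integrated series converges, so the series is finite almost
  -- everywhere.
  have h1 : ∀ n : ℕ, ∀ᵐ x ∂μ,
      Summable fun k => |e k x| * Real.exp (-((1 / (n + 1 : ℝ)) * r k)) := by
    intro n
    set w : ι → ℝ := fun k => Real.exp (-((1 / (n + 1 : ℝ)) * r k))
    have hw : ∀ k, 0 < w k := fun k => Real.exp_pos _
    have hi : ∀ k, Integrable (fun x => |e k x| * w k) μ :=
      fun k => ((he k).integrable (by norm_num)).abs.mul_const _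
    have hbd : ∀ k, ∫ x, |e k x| * w k ∂μ ≤ (1 + μ.real univ) / 2 * w k := by
      intro k
      rw [integral_mul_const]
      refine mul_le_mul_of_nonneg_right ?_ (hw k).le
      have := integral_abs_mul_le (he k) (memLp_const (1 : ℝ) (μ := μ) (p := 2))
      simpa [ho] using this
    have hsum : Summable fun k => ∫ x, |e k x| * w k ∂μ :=
      Summable.of_nonneg_of_le
        (fun k => integral_nonneg fun x => mul_nonneg (abs_nonneg _) (hw k).le) hbd
        ((hs _ (by positivity)).mul_left _)
    have hlt : ∫⁻ x, ∑' k, ENNReal.ofReal (|e k x| * w k) ∂μ ≠ ∞ := by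
      rw [lintegral_tsum fun k => (hi k).aemeasurable.ennreal_ofReal]
      simp_rw [← ofReal_integral_eq_lintegral_ofReal (hi _)
        (ae_of_all _ fun x => mul_nonneg (abs_nonneg _) (hw _).le)]
      exact hsum.tsum_ofReal_ne_top
    have := ae_lt_top' (AEMeasurable.tsum fun k => (hi k).aemeasurable.ennreal_ofReal) hlt
    filter_upwards [this] with x hx
    refine (ENNReal.summable_toReal hx.ne).congr fun k => ?_
    exact ENNReal.toReal_ofReal (mul_nonneg (abs_nonneg _) (hw _).le)
  filter_upwards [ae_all_iff.mpr h1] with x hx t ht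
  obtain ⟨n, hn⟩ := exists_nat_one_div_lt ht
  refine Summable.of_nonneg_of_le (fun k => by positivity) (fun k => ?_) (hx n)
  have := hr k
  gcongr

/-- Partial sums are bounded in `L¹` by `integral_abs_sum_le` with `τ = t exp(-t)`: as `r = 0` or `r
≥ 1`, each coefficient divided by `τ` is at most `|r c|` in absolute value. Fatou's lemma passes to
the limit. The surviving factor `t` is what allows Mellin exponents down to `-1`. -/
theorem integrable_poissonQSeries (he : ∀ k, MemLp (e k) 2 μ)
    (ho : ∀ k l, ∫ x, e k x * e l x ∂μ = if k = l then 1 else 0) (hr : ∀ k, 0 ≤ r k)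
    (hr1 : ∀ k, r k ≠ 0 → 1 ≤ r k) {M : ℝ} (hM : ∀ k, |c k| ≤ M)
    (hc : Summable fun k => (r k * c k) ^ 2)
    (hs : ∀ t : ℝ, 0 < t → Summable fun k => Real.exp (-(t * r k))) {t : ℝ} (ht : 0 < t) :
    Integrable (poissonQSeries e r c t) μ ∧ ∫ x, |poissonQSeries e r c t x| ∂μ ≤
      t * Real.exp (-t) * ((μ.real univ + ∑' k, (r k * c k) ^ 2) / 2) := by
  set b : ι → ℝ := fun k => t * c k * (r k * Real.exp (-(t * r k))) with hb
  set K := t * Real.exp (-t) * ((μ.real univ + ∑' k, (r k * c k) ^ 2) / 2) with hK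
  have hK0 : 0 ≤ K := by
    have : 0 ≤ ∑' k, (r k * c k) ^ 2 := tsum_nonneg fun k => sq_nonneg _
    positivity
  have hτ : 0 < t * Real.exp (-t) := by positivity
  have hbd : ∀ S : Finset ι, ∫ x, |∑ k ∈ S, b k * e k x| ∂μ ≤ K := by
    intro S
    refine (integral_abs_sum_le he ho S b hτ).trans ?_
    rw [hK, mul_div_assoc]
    refine mul_le_mul_of_nonneg_left (div_le_div_of_nonneg_right (add_le_add_right ?_ _) two_pos.le)
      hτ.le
    refine (Finset.sum_le_sum fun k _ => ?_).trans (hc.sum_le_tsum S fun k _ => sq_nonneg _)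
    rw [sq_le_sq]
    rcases eq_or_ne (r k) 0 with h0 | h0
    · simp [hb, h0]
    · have h1 : Real.exp (-(t * r k)) ≤ Real.exp (-t) := by
        have := hr1 k h0
        gcongr
        nlinarith
      have h2 : b k / (t * Real.exp (-t)) =
          (r k * c k) * (Real.exp (-(t * r k)) / Real.exp (-t)) := by
        rw [hb]; field_simp
      rw [h2, abs_mul, abs_of_nonneg (by positivity : 0 ≤ Real.exp (-(t * r k)) / Real.exp (-t))]
      exact mul_le_of_le_one_right (abs_nonneg _) (div_le_one_of_le₀ h1 (Real.exp_pos _).le)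
  obtain ⟨S, hS⟩ := exists_seq_tendsto (atTop : Filter (Finset ι))
  have hi : ∀ n, Integrable (fun x => ∑ k ∈ S n, b k * e k x) μ := fun n =>
    integrable_finsetSum _ fun k _ => ((he k).integrable (by norm_num)).const_mul _
  have hlim : ∀ᵐ x ∂μ, Tendsto (fun n => ∑ k ∈ S n, b k * e k x) atTop
      (𝓝 (poissonQSeries e r c t x)) := by
    filter_upwards [ae_summable_abs_mul_exp he ho hr hs] with x hx
    have h2 : Summable fun k => b k * e k x := (summable_coeff_mul hr hM hx ht).of_norm
    exact h2.hasSum.comp hS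
  have hmeas : AEStronglyMeasurable (poissonQSeries e r c t) μ :=
    aestronglyMeasurable_of_tendsto_ae _ (fun n => (hi n).1) hlim
  have hlint : ∫⁻ x, ‖poissonQSeries e r c t x‖ₑ ∂μ ≤ ENNReal.ofReal K := by
    have h1 : ∫⁻ x, ‖poissonQSeries e r c t x‖ₑ ∂μ ≤
        ∫⁻ x, liminf (fun n => ‖∑ k ∈ S n, b k * e k x‖ₑ) atTop ∂μ := by
      refine lintegral_mono_ae ?_
      filter_upwards [hlim] with x hx
      exact hx.enorm.liminf_eq.ge
    refine h1.trans ((lintegral_liminf_le' fun n => (hi n).1.enorm).trans ?_)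
    refine liminf_le_of_le (by isBoundedDefault) fun a ha => ?_
    obtain ⟨n, hn⟩ := ha.exists
    refine hn.trans ?_
    rw [← ofReal_integral_norm_eq_lintegral_enorm (hi n)]
    exact ENNReal.ofReal_le_ofReal (hbd (S n))
  have hint : Integrable (poissonQSeries e r c t) μ :=
    ⟨hmeas, hlint.trans_lt ENNReal.ofReal_lt_top⟩
  refine ⟨hint, ?_⟩
  rw [← ofReal_integral_norm_eq_lintegral_enorm hint, ENNReal.ofReal_le_ofReal_iff hK0] at hlint
  exact hlint

end Expansion

/-! ### Mellin transforms of the Poisson extension -/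

section Mellin

variable {X : Type*} [MeasurableSpace X] {μ : Measure X} [IsFiniteMeasure μ]
  {ι : Type*} [Countable ι] [DecidableEq ι] {e : ι → X → ℝ} {r c : ι → ℝ}

/-- The `L¹` bound reduces integrability to that of `t^σ exp(-t)`, the integrand of `Γ(σ+1)`, which
converges for `σ > -1`. -/
theorem integrable_prod_poissonQSeries (he : ∀ k, MemLp (e k) 2 μ)
    (ho : ∀ k l, ∫ x, e k x * e l x ∂μ = if k = l then 1 else 0) (hr : ∀ k, 0 ≤ r k)
    (hr1 : ∀ k, r k ≠ 0 → 1 ≤ r k) {M : ℝ} (hM : ∀ k, |c k| ≤ M)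
    (hc : Summable fun k => (r k * c k) ^ 2)
    (hs : ∀ t : ℝ, 0 < t → Summable fun k => Real.exp (-(t * r k))) {σ : ℝ} (hσ : -1 < σ) :
    Integrable (fun p : ℝ × X => p.1 ^ (σ - 1) * poissonQSeries e r c p.1 p.2)
      ((volume.restrict (Ioi (0 : ℝ))).prod μ) := by
  set ν := volume.restrict (Ioi (0 : ℝ))
  have hpos : ∀ᵐ t ∂ν, 0 < t := ae_restrict_mem measurableSet_Ioi
  obtain ⟨S, hS⟩ := exists_seq_tendsto (atTop : Filter (Finset ι))
  have hmeas : AEStronglyMeasurable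
      (fun p : ℝ × X => p.1 ^ (σ - 1) * poissonQSeries e r c p.1 p.2) (ν.prod μ) := by
    refine AEStronglyMeasurable.mul
      (by fun_prop : Measurable fun p : ℝ × X => p.1 ^ (σ - 1)).aestronglyMeasurable ?_
    refine aestronglyMeasurable_of_tendsto_ae atTop (f := fun n (p : ℝ × X) =>
      ∑ k ∈ S n, p.1 * c k * (r k * Real.exp (-(p.1 * r k))) * e k p.2) (fun n => ?_) ?_
    · refine Finset.aestronglyMeasurable_fun_sum _ fun k _ => AEStronglyMeasurable.mul
        (by fun_prop : Measurable fun p : ℝ × X =>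
          p.1 * c k * (r k * Real.exp (-(p.1 * r k)))).aestronglyMeasurable ?_
      exact (he k).1.comp_snd
    · filter_upwards [Measure.quasiMeasurePreserving_fst.ae hpos,
        Measure.quasiMeasurePreserving_snd.ae (ae_summable_abs_mul_exp he ho hr hs)] with p hp hx
      refine (Summable.hasSum ?_).comp hS
      exact (summable_coeff_mul hr hM (fun t ht => hx t ht) hp).of_norm
  rw [integrable_prod_iff hmeas]
  have hq := fun (t : ℝ) (ht : 0 < t) => integrable_poissonQSeries he ho hr hr1 hM hc hs ht
  refine ⟨hpos.mono fun t ht => (hq t ht).1.const_mul (t ^ (σ - 1)), ?_⟩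
  set K := (μ.real univ + ∑' k, (r k * c k) ^ 2) / 2
  have hG : IntegrableOn (fun t : ℝ => Real.exp (-t) * t ^ (σ + 1 - 1) * K) (Ioi 0) :=
    (Real.GammaIntegral_convergent (by linarith)).mul_const K
  refine Integrable.mono' hG hmeas.norm.integral_prod_right' ?_
  filter_upwards [hpos] with t ht
  have hp : 0 ≤ t ^ (σ - 1) := Real.rpow_nonneg ht.le _
  rw [Real.norm_eq_abs, abs_of_nonneg (integral_nonneg fun x => norm_nonneg _)]
  simp_rw [norm_mul, Real.norm_eq_abs, abs_of_nonneg hp, integral_const_mul]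
  refine (mul_le_mul_of_nonneg_left (hq t ht).2 hp).trans_eq ?_
  rw [show σ + 1 - 1 = σ - 1 + 1 by ring, Real.rpow_add_one ht.ne']
  ring

/-- Fubini, then the Gamma integral `∫ t^σ exp(-r t) dt = Γ(σ+1) r^(-σ-1)` for each coefficient.
Boundedness of each `e k` keeps the product with it integrable. -/
theorem mellin_poissonQSeries (he : ∀ k, MemLp (e k) 2 μ)
    (ho : ∀ k l, ∫ x, e k x * e l x ∂μ = if k = l then 1 else 0)
    (hb : ∀ k, ∃ C, ∀ᵐ x ∂μ, ‖e k x‖ ≤ C) (hr : ∀ k, 0 ≤ r k)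
    (hr1 : ∀ k, r k ≠ 0 → 1 ≤ r k) {M : ℝ} (hM : ∀ k, |c k| ≤ M)
    (hc : Summable fun k => (r k * c k) ^ 2)
    (hs : ∀ t : ℝ, 0 < t → Summable fun k => Real.exp (-(t * r k))) {σ : ℝ} (hσ : -1 < σ) :
    (∀ᵐ x ∂μ, IntegrableOn (fun t => t ^ (σ - 1) * poissonQSeries e r c t x) (Ioi (0 : ℝ))) ∧
    Integrable (fun x => ∫ t in Ioi (0 : ℝ), t ^ (σ - 1) * poissonQSeries e r c t x) μ ∧
    ∀ l, ∫ x, (∫ t in Ioi (0 : ℝ), t ^ (σ - 1) * poissonQSeries e r c t x) * e l x ∂μ =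
      if r l = 0 then 0 else Real.Gamma (σ + 1) * (r l ^ (-σ) * c l) := by
  have hi := integrable_prod_poissonQSeries he ho hr hr1 hM hc hs hσ
  refine ⟨hi.prod_left_ae, hi.integral_prod_right, fun l => ?_⟩
  obtain ⟨C, hC⟩ := hb l
  have hi2 : Integrable (fun p : ℝ × X => p.1 ^ (σ - 1) * poissonQSeries e r c p.1 p.2 * e l p.2)
      ((volume.restrict (Ioi (0 : ℝ))).prod μ) :=
    hi.mul_bdd (he l).1.comp_snd (Measure.quasiMeasurePreserving_snd.ae hC)
  simp_rw [← integral_mul_const]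
  rw [← integral_integral_swap hi2]
  have h1 : ∀ t ∈ Ioi (0 : ℝ), ∫ x, t ^ (σ - 1) * poissonQSeries e r c t x * e l x ∂μ =
      r l * c l * (t ^ (σ + 1 - 1) * Real.exp (-(r l * t))) := by
    intro t ht
    simp_rw [mul_assoc, integral_const_mul]
    rw [integral_poissonQSeries_mul he ho hr hM hs ht, show σ + 1 - 1 = σ - 1 + 1 by ring,
      Real.rpow_add_one (ne_of_gt ht), mul_comm (r l) t]
    ring
  rw [setIntegral_congr_fun measurableSet_Ioi h1, integral_const_mul]
  split_ifs with h0
  · simp [h0]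
  · have hl : 0 < r l := lt_of_le_of_ne (hr l) (Ne.symm h0)
    rw [Real.integral_rpow_mul_exp_neg_mul_Ioi (by linarith) hl, one_div,
      Real.inv_rpow hl.le, ← Real.rpow_neg hl.le, show -σ = -(σ + 1) + 1 by ring,
      Real.rpow_add_one hl.ne']
    ring

end Mellin

/-! ### `L²` theory of Jacobi expansions -/

section LTwo

variable {d : ℕ} {α β : Fin d → ℝ}

theorem jacobiCoeff_const_mul (a : ℝ) (g : (Fin d → ℝ) → ℝ) (κ : Fin d → ℕ) :
    jacobiCoeff α β (fun x => a * g x) κ = a * jacobiCoeff α β g κ := by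
  simp_rw [jacobiCoeff, mul_assoc, integral_const_mul]

/-- Jacobi coefficients are continuous in `L^p`. -/
theorem TendstoLp.tendsto_jacobiCoeff (hα : ∀ i, -(1 / 2 : ℝ) < α i)
    (hβ : ∀ i, -(1 / 2 : ℝ) < β i) {p : ℝ≥0∞} (hp : 1 ≤ p) {u : ℕ → (Fin d → ℝ) → ℝ}
    {g : (Fin d → ℝ) → ℝ} (hu : ∀ n, Continuous (u n)) (h : TendstoLp α β p u g)
    (κ : Fin d → ℕ) :
    Tendsto (fun n => jacobiCoeff α β (u n) κ) atTop (𝓝 (jacobiCoeff α β g κ)) := by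
  have := isFiniteMeasure_jacobiMeasure hα hβ
  obtain ⟨hg, hlim⟩ := h
  have hg1 : Integrable g (jacobiMeasure α β) := hg.integrable hp
  have hc := (continuous_jacobiPoly α β κ).continuousOn (s := Icc (-1) 1)
  obtain ⟨C, hC⟩ := isCompact_Icc.exists_bound_of_continuousOn hc
  refine tendsto_integral_of_L1' _
    (integrable_mul_jacobiMeasure_of_continuousOn hα hβ hc hg1).aestronglyMeasurable
    (Eventually.of_forall fun n => integrable_jacobiMeasure_of_continuousOn hα hβ
      ((hu n).mul (continuous_jacobiPoly α β κ)).continuousOn) ?_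
  -- The Hölder factor comparing `L¹` with `L^p` on a finite measure space.
  set m := jacobiMeasure α β univ ^ (1 / (1 : ℝ≥0∞).toReal - 1 / p.toReal)
  have hm : m ≠ ∞ := by
    refine ENNReal.rpow_ne_top_of_nonneg ?_ (measure_ne_top _ _)
    rcases eq_or_ne p ∞ with rfl | hpt
    · simp
    · have h1 : 1 ≤ p.toReal := by
        simpa using ENNReal.toReal_mono hpt hp
      rw [ENNReal.toReal_one, sub_nonneg]
      exact one_div_le_one_div_of_le one_pos h1
  have hz : Tendsto (fun n => ENNReal.ofReal C * (eLpNorm (u n - g) p (jacobiMeasure α β) * m))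
      atTop (𝓝 0) := by
    have := ENNReal.Tendsto.const_mul (a := ENNReal.ofReal C)
      (ENNReal.Tendsto.mul_const hlim (Or.inr hm)) (Or.inr ENNReal.ofReal_ne_top)
    simpa using this
  refine tendsto_of_tendsto_of_tendsto_of_le_of_le tendsto_const_nhds hz (fun n => zero_le)
    fun n => ?_
  have h1 : eLpNorm (u n - g) 1 (jacobiMeasure α β) ≤
      eLpNorm (u n - g) p (jacobiMeasure α β) * m :=
    eLpNorm_le_eLpNorm_mul_rpow_measure_univ hp ((hu n).aestronglyMeasurable.sub hg.1)
  refine le_trans (eLpNorm_le_mul_eLpNorm_of_ae_le_mul ?_ 1) (mul_le_mul_right h1 _)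
  filter_upwards [ae_mem_Icc_jacobiMeasure hα hβ] with x hx
  simp only [Pi.sub_apply, ← sub_mul, norm_mul]
  rw [mul_comm]
  exact mul_le_mul_of_nonneg_right (hC x hx) (norm_nonneg _)

theorem orthonormal_jacobiPoly (hα : ∀ i, -(1 / 2 : ℝ) < α i) (hβ : ∀ i, -(1 / 2 : ℝ) < β i) :
    Orthonormal ℝ fun κ => (memLp_jacobiMeasure_of_continuousOn hα hβ
      (continuous_jacobiPoly α β κ).continuousOn 2).toLp := by
  rw [orthonormal_iff_ite]
  intro κ κ'
  rw [← integral_jacobiPoly_mul hα hβ κ κ', L2.inner_def]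
  refine integral_congr_ae ?_
  filter_upwards [MemLp.coeFn_toLp (memLp_jacobiMeasure_of_continuousOn hα hβ
      (continuous_jacobiPoly α β κ).continuousOn 2),
    MemLp.coeFn_toLp (memLp_jacobiMeasure_of_continuousOn hα hβ
      (continuous_jacobiPoly α β κ').continuousOn 2)] with x h1 h2
  rw [h1, h2]
  simp [mul_comm]

/-- Bessel's inequality. -/
theorem summable_jacobiCoeff_sq (hα : ∀ i, -(1 / 2 : ℝ) < α i) (hβ : ∀ i, -(1 / 2 : ℝ) < β i)
    {g : (Fin d → ℝ) → ℝ} (hg : MemLp g 2 (jacobiMeasure α β)) :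
    Summable fun κ => jacobiCoeff α β g κ ^ 2 := by
  refine ((orthonormal_jacobiPoly hα hβ).inner_products_summable hg.toLp).congr fun κ => ?_
  rw [L2.inner_def, Real.norm_eq_abs, sq_abs]
  congr 1
  refine integral_congr_ae ?_
  filter_upwards [hg.coeFn_toLp, MemLp.coeFn_toLp (memLp_jacobiMeasure_of_continuousOn hα hβ
      (continuous_jacobiPoly α β κ).continuousOn 2)] with x h1 h2
  rw [h1, h2]
  simp

theorem abs_jacobiCoeff_le (hα : ∀ i, -(1 / 2 : ℝ) < α i) (hβ : ∀ i, -(1 / 2 : ℝ) < β i)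
    {g : (Fin d → ℝ) → ℝ} (hg : MemLp g 2 (jacobiMeasure α β)) (κ : Fin d → ℕ) :
    |jacobiCoeff α β g κ| ≤ (∫ x, g x * g x ∂jacobiMeasure α β + 1) / 2 := by
  have h := integral_abs_mul_le hg (memLp_jacobiMeasure_of_continuousOn hα hβ
    (continuous_jacobiPoly α β κ).continuousOn 2)
  rw [integral_jacobiPoly_mul hα hβ, if_pos rfl] at h
  exact abs_integral_le_integral_abs.trans h

/-- The Riesz–Fischer theorem. -/
theorem exists_tendstoLp_sum (hα : ∀ i, -(1 / 2 : ℝ) < α i) (hβ : ∀ i, -(1 / 2 : ℝ) < β i)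
    {a : (Fin d → ℕ) → ℝ} (ha : Summable fun κ => a κ ^ 2) {S : ℕ → Finset (Fin d → ℕ)}
    (hS : Tendsto S atTop atTop) :
    ∃ g, TendstoLp α β 2 (fun n x => ∑ κ ∈ S n, a κ * jacobiPoly α β κ x) g ∧
      ∀ κ, jacobiCoeff α β g κ = a κ := by
  have hm := fun κ => memLp_jacobiMeasure_of_continuousOn hα hβ
    (continuous_jacobiPoly α β κ).continuousOn 2
  have ho := orthonormal_jacobiPoly hα hβ
  have hsum : Summable fun κ => a κ • (hm κ).toLp := by
    have := (ho.orthogonalFamily.summable_iff_norm_sq_summable a).mpr (by simpa using ha)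
    simpa using this
  have hms : ∀ s : Finset (Fin d → ℕ), MemLp (fun x => ∑ κ ∈ s, a κ * jacobiPoly α β κ x) 2
      (jacobiMeasure α β) := fun s => memLp_finsetSum _ fun κ _ => (hm κ).const_mul _
  have hsumLp : ∀ s : Finset (Fin d → ℕ), ∑ κ ∈ s, a κ • (hm κ).toLp = (hms s).toLp := by
    intro s
    induction s using Finset.induction_on with
    | empty =>
      simp only [Finset.sum_empty]
      exact (MemLp.toLp_zero (MemLp.zero' (p := 2) (μ := jacobiMeasure α β))).symm
    | insert κ s hκ ih =>
      rw [Finset.sum_insert hκ, ih, ← MemLp.toLp_const_smul, ← MemLp.toLp_add]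
      congr 1
      ext x
      simp [Finset.sum_insert hκ]
  set G := ∑' κ, a κ • (hm κ).toLp
  have hG : Tendsto (fun n => (hms (S n)).toLp) atTop (𝓝 G) := by
    simpa only [Function.comp_def, hsumLp] using hsum.hasSum.comp hS
  have hT : TendstoLp α β 2 (fun n x => ∑ κ ∈ S n, a κ * jacobiPoly α β κ x) G := by
    refine ⟨Lp.memLp G, ?_⟩
    rw [← Lp.toLp_coeFn G (Lp.memLp G), Lp.tendsto_Lp_iff_tendsto_eLpNorm''] at hG
    exact hG
  refine ⟨G, hT, fun κ => ?_⟩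
  have h1 := hT.tendsto_jacobiCoeff hα hβ one_le_two (fun n => by fun_prop) κ
  refine tendsto_nhds_unique h1 (tendsto_const_nhds.congr' ?_)
  filter_upwards [hS.eventually (eventually_ge_atTop {κ})] with n hn
  rw [jacobiCoeff_sum hα hβ, if_pos (hn (Finset.mem_singleton_self κ))]

/-- The partial sums of the Jacobi expansion of `f`, as polynomials. -/
def partialSum (α β : Fin d → ℝ) (f : (Fin d → ℝ) → ℝ) (S : Finset (Fin d → ℕ)) :
    MvPolynomial (Fin d) ℝ :=
  ∑ κ ∈ S, MvPolynomial.C (jacobiCoeff α β f κ) * jacobiMvPolynomial α β κ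

theorem eval_partialSum (f : (Fin d → ℝ) → ℝ) (S : Finset (Fin d → ℕ)) (x : Fin d → ℝ) :
    MvPolynomial.eval x (partialSum α β f S) =
      ∑ κ ∈ S, jacobiCoeff α β f κ * jacobiPoly α β κ x := by
  simp only [partialSum, map_sum, map_mul, MvPolynomial.eval_C, eval_jacobiMvPolynomial]

/-- The Riesz–Fischer limit has the coefficients of `f`, hence equals `f` almost everywhere. -/
theorem tendstoLp_partialSum (hα : ∀ i, -(1 / 2 : ℝ) < α i) (hβ : ∀ i, -(1 / 2 : ℝ) < β i)
    {f : (Fin d → ℝ) → ℝ} (hf : MemLp f 2 (jacobiMeasure α β)) {S : ℕ → Finset (Fin d → ℕ)}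
    (hS : Tendsto S atTop atTop) :
    TendstoLp α β 2 (fun n x => MvPolynomial.eval x (partialSum α β f (S n))) f := by
  have := isFiniteMeasure_jacobiMeasure hα hβ
  obtain ⟨g, hg, hc⟩ := exists_tendstoLp_sum hα hβ (summable_jacobiCoeff_sq hα hβ hf) hS
  have hae := ae_eq_of_jacobiCoeff_eq hα hβ (hg.1.integrable one_le_two)
    (hf.integrable one_le_two) hc
  refine ⟨hf, hg.2.congr fun n => eLpNorm_congr_ae ?_⟩
  filter_upwards [hae] with x hx
  simp only [Pi.sub_apply, hx, eval_partialSum]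

theorem exists_tendstoLp_spectralOp (hα : ∀ i, -(1 / 2 : ℝ) < α i)
    (hβ : ∀ i, -(1 / 2 : ℝ) < β i) {f : (Fin d → ℝ) → ℝ} (Φ : ℝ → ℝ)
    (hΦ : Summable fun κ => (Φ (eigenvalue α β κ) * jacobiCoeff α β f κ) ^ 2)
    {S : ℕ → Finset (Fin d → ℕ)} (hS : Tendsto S atTop atTop) :
    ∃ g, TendstoLp α β 2 (fun n => spectralOp α β Φ (partialSum α β f (S n))) g := by
  obtain ⟨g, hg, -⟩ := exists_tendstoLp_sum hα hβ hΦ hS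
  refine ⟨g, ?_⟩
  have : (fun n => spectralOp α β Φ (partialSum α β f (S n))) = fun n x =>
      ∑ κ ∈ S n, Φ (eigenvalue α β κ) * jacobiCoeff α β f κ * jacobiPoly α β κ x := by
    ext n x
    exact spectralOp_eq_sum hα hβ Φ _ _ _ (eval_partialSum f (S n)) x
  rwa [this]

theorem spectralOp_sub (hα : ∀ i, -(1 / 2 : ℝ) < α i) (hβ : ∀ i, -(1 / 2 : ℝ) < β i) (Φ : ℝ → ℝ)
    (q q' : MvPolynomial (Fin d) ℝ) :
    spectralOp α β Φ (q - q') = spectralOp α β Φ q - spectralOp α β Φ q' := by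
  obtain ⟨c, hc⟩ := exists_eval_eq_sum_jacobiPoly hα hβ q
  obtain ⟨c', hc'⟩ := exists_eval_eq_sum_jacobiPoly hα hβ q'
  set s := c.support ∪ c'.support
  have h1 : ∀ x, MvPolynomial.eval x q = ∑ κ ∈ s, c κ * jacobiPoly α β κ x := fun x => by
    rw [hc]
    refine Finset.sum_subset Finset.subset_union_left fun κ _ hκ => ?_
    rw [Finsupp.notMem_support_iff.mp hκ, zero_mul]
  have h2 : ∀ x, MvPolynomial.eval x q' = ∑ κ ∈ s, c' κ * jacobiPoly α β κ x := fun x => by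
    rw [hc']
    refine Finset.sum_subset Finset.subset_union_right fun κ _ hκ => ?_
    rw [Finsupp.notMem_support_iff.mp hκ, zero_mul]
  have h3 : ∀ x, MvPolynomial.eval x (q - q') =
      ∑ κ ∈ s, (c κ - c' κ) * jacobiPoly α β κ x := fun x => by
    rw [map_sub, h1, h2, ← Finset.sum_sub_distrib]
    exact Finset.sum_congr rfl fun κ _ => by ring
  ext x
  rw [Pi.sub_apply, spectralOp_eq_sum hα hβ Φ _ s _ h1, spectralOp_eq_sum hα hβ Φ _ s _ h2,
    spectralOp_eq_sum hα hβ Φ _ s _ h3, ← Finset.sum_sub_distrib]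
  exact Finset.sum_congr rfl fun κ _ => by ring

/-- The images of the partial sums under `(I - L)^(γ/2)` converge in `L²`, so they are Cauchy there.
-/
theorem tendstoSobolev_partialSum (hα : ∀ i, -(1 / 2 : ℝ) < α i)
    (hβ : ∀ i, -(1 / 2 : ℝ) < β i) {f : (Fin d → ℝ) → ℝ} (hf : MemLp f 2 (jacobiMeasure α β))
    {γ : ℝ} (hγ : Summable fun κ =>
      ((1 + eigenvalue α β κ) ^ (γ / 2) * jacobiCoeff α β f κ) ^ 2)
    {S : ℕ → Finset (Fin d → ℕ)} (hS : Tendsto S atTop atTop) :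
    TendstoSobolev α β 2 γ (fun n => partialSum α β f (S n)) f := by
  refine ⟨fun ε hε => ?_, tendstoLp_partialSum hα hβ hf hS⟩
  obtain ⟨g, hg⟩ := exists_tendstoLp_spectralOp hα hβ (fun r => (1 + r) ^ (γ / 2)) hγ hS
  obtain ⟨N, hN⟩ := eventually_atTop.mp (hg.2.eventually (gt_mem_nhds (ENNReal.half_pos hε.ne')))
  refine ⟨N, fun m hm n hn => ?_⟩
  rw [sobolevNorm, spectralOp_sub hα hβ,
    ← sub_sub_sub_cancel_right _ _ g]
  have hmeas : ∀ n, AEStronglyMeasurable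
      (spectralOp α β (fun r => (1 + r) ^ (γ / 2)) (partialSum α β f (S n)) - g)
      (jacobiMeasure α β) := fun n =>
    (continuous_spectralOp hα hβ _ _).aestronglyMeasurable.sub hg.1.1
  refine (eLpNorm_sub_le (hmeas m) (hmeas n) one_le_two).trans_lt ?_
  rw [← ENNReal.add_halves ε]
  exact ENNReal.add_lt_add (hN m hm) (hN n hn)

end LTwo

/-! ### The Poisson–Jacobi semigroup of a `C²` function -/

section Poisson

variable {d : ℕ} {α β : Fin d → ℝ}

theorem sq_le_eigenvalue_term (hα : ∀ i, -(1 / 2 : ℝ) < α i) (hβ : ∀ i, -(1 / 2 : ℝ) < β i)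
    (κ : Fin d → ℕ) (i : Fin d) : (κ i : ℝ) ^ 2 ≤ κ i * (κ i + α i + β i + 1) := by
  rw [pow_two]
  exact mul_le_mul_of_nonneg_left (by linarith [hα i, hβ i]) (Nat.cast_nonneg _)

theorem sq_le_eigenvalue (hα : ∀ i, -(1 / 2 : ℝ) < α i) (hβ : ∀ i, -(1 / 2 : ℝ) < β i)
    (κ : Fin d → ℕ) (i : Fin d) : (κ i : ℝ) ^ 2 ≤ eigenvalue α β κ :=
  (sq_le_eigenvalue_term hα hβ κ i).trans (Finset.single_le_sum
    (f := fun i => (κ i : ℝ) * (κ i + α i + β i + 1))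
    (fun j _ => (sq_nonneg _).trans (sq_le_eigenvalue_term hα hβ κ j)) (Finset.mem_univ i))

theorem eigenvalue_nonneg (hα : ∀ i, -(1 / 2 : ℝ) < α i) (hβ : ∀ i, -(1 / 2 : ℝ) < β i)
    (κ : Fin d → ℕ) : 0 ≤ eigenvalue α β κ :=
  Finset.sum_nonneg fun j _ => (sq_nonneg _).trans (sq_le_eigenvalue_term hα hβ κ j)

/-- The spectral gap: `α_i + β_i + 1 > 0` gives `λ_κ ≥ κ_i²` for every `i`. -/
theorem one_le_eigenvalue (hα : ∀ i, -(1 / 2 : ℝ) < α i) (hβ : ∀ i, -(1 / 2 : ℝ) < β i)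
    {κ : Fin d → ℕ} (h : eigenvalue α β κ ≠ 0) : 1 ≤ eigenvalue α β κ := by
  obtain ⟨i, hi⟩ : ∃ i, κ i ≠ 0 := by
    by_contra! h0
    exact h (by simp [eigenvalue, h0])
  refine le_trans ?_ (sq_le_eigenvalue hα hβ κ i)
  exact one_le_pow₀ (by exact_mod_cast Nat.one_le_iff_ne_zero.mpr hi)

/-- The square root of the eigenvalue. -/
def sqrtEigenvalue (α β : Fin d → ℝ) (κ : Fin d → ℕ) : ℝ := √(eigenvalue α β κ)

theorem sqrtEigenvalue_nonneg (κ : Fin d → ℕ) : 0 ≤ sqrtEigenvalue α β κ := Real.sqrt_nonneg _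

theorem sqrtEigenvalue_sq (hα : ∀ i, -(1 / 2 : ℝ) < α i) (hβ : ∀ i, -(1 / 2 : ℝ) < β i)
    (κ : Fin d → ℕ) : sqrtEigenvalue α β κ ^ 2 = eigenvalue α β κ :=
  Real.sq_sqrt (eigenvalue_nonneg hα hβ κ)

theorem sqrtEigenvalue_eq_zero_iff (hα : ∀ i, -(1 / 2 : ℝ) < α i)
    (hβ : ∀ i, -(1 / 2 : ℝ) < β i) (κ : Fin d → ℕ) :
    sqrtEigenvalue α β κ = 0 ↔ eigenvalue α β κ = 0 :=
  Real.sqrt_eq_zero (eigenvalue_nonneg hα hβ κ)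

theorem one_le_sqrtEigenvalue (hα : ∀ i, -(1 / 2 : ℝ) < α i) (hβ : ∀ i, -(1 / 2 : ℝ) < β i)
    (κ : Fin d → ℕ) (h : sqrtEigenvalue α β κ ≠ 0) : 1 ≤ sqrtEigenvalue α β κ :=
  Real.one_le_sqrt.mpr (one_le_eigenvalue hα hβ fun h0 =>
    h ((sqrtEigenvalue_eq_zero_iff hα hβ κ).mpr h0))

theorem sqrtEigenvalue_rpow (hα : ∀ i, -(1 / 2 : ℝ) < α i) (hβ : ∀ i, -(1 / 2 : ℝ) < β i)
    (κ : Fin d → ℕ) (s : ℝ) : sqrtEigenvalue α β κ ^ s = eigenvalue α β κ ^ (s / 2) := by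
  rw [sqrtEigenvalue, Real.sqrt_eq_rpow, ← Real.rpow_mul (eigenvalue_nonneg hα hβ κ)]
  congr 1
  ring

theorem summable_prod_pow (d : ℕ) {ρ : ℝ} (h0 : 0 ≤ ρ) (h1 : ρ < 1) :
    Summable fun κ : Fin d → ℕ => ∏ i, ρ ^ κ i := by
  refine summable_of_sum_le (c := ∏ _i : Fin d, (1 - ρ)⁻¹)
    (fun κ => Finset.prod_nonneg fun i _ => pow_nonneg h0 _) fun S => ?_
  -- Every finite set of multi-indices lies in a box, over which the sum factors into
  -- one-dimensional geometric sums.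
  have hS : S ⊆ Fintype.piFinset fun i => S.image fun κ => κ i := by
    intro κ hκ
    exact Fintype.mem_piFinset.mpr fun i => Finset.mem_image_of_mem _ hκ
  refine (Finset.sum_le_sum_of_subset_of_nonneg hS
    fun κ _ _ => Finset.prod_nonneg fun i _ => pow_nonneg h0 _).trans ?_
  rw [← Finset.prod_univ_sum (fun i => S.image fun κ => κ i) fun _ k => ρ ^ k]
  refine Finset.prod_le_prod (fun i _ => Finset.sum_nonneg fun k _ => pow_nonneg h0 _) fun i _ => ?_
  rw [← tsum_geometric_of_lt_one h0 h1]
  exact (summable_geometric_of_lt_one h0 h1).sum_le_tsum _ fun k _ => pow_nonneg h0 _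

theorem summable_exp_sqrtEigenvalue (hα : ∀ i, -(1 / 2 : ℝ) < α i)
    (hβ : ∀ i, -(1 / 2 : ℝ) < β i) {t : ℝ} (ht : 0 < t) :
    Summable fun κ => Real.exp (-(t * sqrtEigenvalue α β κ)) := by
  -- From `∑ κ_i ≤ d √λ_κ`; the denominator is `d + 1` so that `d = 0` is covered.
  have hρ : Real.exp (-(t / (d + 1))) < 1 := Real.exp_lt_one_iff.mpr (by
    have : 0 < t / (d + 1) := by positivity
    linarith)
  refine Summable.of_nonneg_of_le (fun κ => (Real.exp_pos _).le) (fun κ => ?_)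
    (summable_prod_pow d (Real.exp_pos _).le hρ)
  simp_rw [← Real.exp_nat_mul]
  rw [← Real.exp_sum, ← Finset.sum_mul, mul_neg]
  refine Real.exp_le_exp.mpr (neg_le_neg ?_)
  have h1 : ∑ i, (κ i : ℝ) ≤ d * sqrtEigenvalue α β κ := by
    have := Finset.sum_le_card_nsmul Finset.univ (fun i => (κ i : ℝ)) (sqrtEigenvalue α β κ)
      fun i _ => Real.le_sqrt_of_sq_le (sq_le_eigenvalue hα hβ κ i)
    simpa using this
  have h2 := sqrtEigenvalue_nonneg (α := α) (β := β) κ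
  rw [mul_div_assoc', div_le_iff₀ (by positivity)]
  nlinarith

/-- At almost every point the Jacobi polynomials grow slower than every exponential of the square
root of the eigenvalue. -/
theorem ae_summable_jacobiPoly (hα : ∀ i, -(1 / 2 : ℝ) < α i) (hβ : ∀ i, -(1 / 2 : ℝ) < β i) :
    ∀ᵐ x ∂jacobiMeasure α β, ∀ t : ℝ, 0 < t →
      Summable fun κ => |jacobiPoly α β κ x| * Real.exp (-(t * sqrtEigenvalue α β κ)) := by
  have := isFiniteMeasure_jacobiMeasure hα hβ
  exact ae_summable_abs_mul_exp (fun κ => memLp_jacobiMeasure_of_continuousOn hα hβ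
    (continuous_jacobiPoly α β κ).continuousOn 2) (integral_jacobiPoly_mul hα hβ)
    sqrtEigenvalue_nonneg fun t ht => summable_exp_sqrtEigenvalue hα hβ ht

theorem jacobiSemigroup_eq_tsum (hα : ∀ i, -(1 / 2 : ℝ) < α i) (hβ : ∀ i, -(1 / 2 : ℝ) < β i)
    {f : (Fin d → ℝ) → ℝ} (hf : MemLp f 2 (jacobiMeasure α β)) {x : Fin d → ℝ}
    (hx : ∀ t : ℝ, 0 < t →
      Summable fun κ => |jacobiPoly α β κ x| * Real.exp (-(t * sqrtEigenvalue α β κ)))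
    {t : ℝ} (ht : 0 < t) : jacobiSemigroup α β t f x =
      ∑' κ, Real.exp (-(sqrtEigenvalue α β κ ^ 2) * t) *
        (jacobiCoeff α β f κ * jacobiPoly α β κ x) := by
  rw [jacobiSemigroup, if_neg ht.ne']
  unfold jacobiKernel
  rw [integral_mul_tsum_kernel (fun κ => memLp_jacobiMeasure_of_continuousOn hα hβ
    (continuous_jacobiPoly α β κ).continuousOn 2) (integral_jacobiPoly_mul hα hβ) hf]
  · refine tsum_congr fun κ => ?_
    rw [sqrtEigenvalue_sq hα hβ, ← jacobiCoeff]
    ring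
  · refine Summable.of_nonneg_of_le (fun κ => abs_nonneg _) (fun κ => ?_) (hx t ht)
    rw [abs_mul, abs_of_pos (Real.exp_pos _), mul_comm]
    refine mul_le_mul_of_nonneg_left (Real.exp_le_exp.mpr ?_) (abs_nonneg _)
    rw [← sqrtEigenvalue_sq hα hβ]
    -- By the gap `r ≤ r²`, so `exp(-λ t) ≤ exp(-r t)`, and summability for the Poisson exponent
    -- controls the Jacobi kernel.
    rcases eq_or_ne (sqrtEigenvalue α β κ) 0 with h | h
    · simp [h]
    · have := one_le_sqrtEigenvalue hα hβ κ h
      nlinarith [mul_le_mul_of_nonneg_left this (by positivity : 0 ≤ t * sqrtEigenvalue α β κ)]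

theorem poissonJacobi_eq_tsum (hα : ∀ i, -(1 / 2 : ℝ) < α i) (hβ : ∀ i, -(1 / 2 : ℝ) < β i)
    {f : (Fin d → ℝ) → ℝ} (hf : MemLp f 2 (jacobiMeasure α β)) {x : Fin d → ℝ}
    (hx : ∀ t : ℝ, 0 < t →
      Summable fun κ => |jacobiPoly α β κ x| * Real.exp (-(t * sqrtEigenvalue α β κ)))
    {t : ℝ} (ht : 0 < t) : poissonJacobi α β t f x =
      ∑' κ, jacobiCoeff α β f κ * jacobiPoly α β κ x * Real.exp (-(t * sqrtEigenvalue α β κ)) := by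
  rw [← integral_subordination_tsum sqrtEigenvalue_nonneg
    (summable_mul_exp_of_bounded (abs_jacobiCoeff_le hα hβ hf) hx) ht, poissonJacobi]
  congr 1
  refine setIntegral_congr_fun measurableSet_Ioi fun u hu => ?_
  have hu0 : (0 : ℝ) < u := hu
  simp only [jacobiSemigroup_eq_tsum hα hβ hf hx (by positivity : 0 < t ^ 2 / (4 * u))]

theorem hasDerivAt_poissonJacobi (hα : ∀ i, -(1 / 2 : ℝ) < α i) (hβ : ∀ i, -(1 / 2 : ℝ) < β i)
    {f : (Fin d → ℝ) → ℝ} (hf : MemLp f 2 (jacobiMeasure α β)) {x : Fin d → ℝ}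
    (hx : ∀ t : ℝ, 0 < t →
      Summable fun κ => |jacobiPoly α β κ x| * Real.exp (-(t * sqrtEigenvalue α β κ)))
    {t : ℝ} (ht : 0 < t) : HasDerivAt (fun s => poissonJacobi α β s f x)
      (∑' κ, jacobiCoeff α β f κ * jacobiPoly α β κ x *
        (-sqrtEigenvalue α β κ * Real.exp (-(t * sqrtEigenvalue α β κ)))) t := by
  refine (hasDerivAt_tsum_mul_exp sqrtEigenvalue_nonneg
    (summable_mul_exp_of_bounded (abs_jacobiCoeff_le hα hβ hf) hx) ht).congr_of_eventuallyEq ?_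
  filter_upwards [lt_mem_nhds ht] with s hs
  exact poissonJacobi_eq_tsum hα hβ hf hx hs

theorem poissonQ_eq (hα : ∀ i, -(1 / 2 : ℝ) < α i) (hβ : ∀ i, -(1 / 2 : ℝ) < β i)
    {f : (Fin d → ℝ) → ℝ} (hf : MemLp f 2 (jacobiMeasure α β)) {x : Fin d → ℝ}
    (hx : ∀ t : ℝ, 0 < t →
      Summable fun κ => |jacobiPoly α β κ x| * Real.exp (-(t * sqrtEigenvalue α β κ)))
    {t : ℝ} (ht : 0 < t) : poissonQ α β t f x = poissonQSeries (jacobiPoly α β)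
      (sqrtEigenvalue α β) (jacobiCoeff α β f) t x := by
  rw [poissonQ, (hasDerivAt_poissonJacobi hα hβ hf hx ht).deriv, poissonQSeries, ← tsum_mul_left]
  exact tsum_congr fun κ => by ring

/-- Bessel's inequality for the Jacobi operator of `f` bounds `∑ λ² f̂²`, and `λ ≤ λ²` by the gap.
This is where two derivatives of `f` are spent. -/
theorem summable_eigenvalue_mul_jacobiCoeff_sq (hα : ∀ i, -(1 / 2 : ℝ) < α i)
    (hβ : ∀ i, -(1 / 2 : ℝ) < β i) {f : (Fin d → ℝ) → ℝ} (hf : ContDiffOn ℝ 2 f (Icc (-1) 1)) :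
    Summable fun κ => (sqrtEigenvalue α β κ * jacobiCoeff α β f κ) ^ 2 := by
  obtain ⟨g, hg, hc⟩ := exists_jacobiOperator hα hβ hf
  refine Summable.of_nonneg_of_le (fun κ => sq_nonneg _) (fun κ => ?_)
    (summable_jacobiCoeff_sq hα hβ (memLp_jacobiMeasure_of_continuousOn hα hβ hg 2))
  rw [hc, mul_pow, sqrtEigenvalue_sq hα hβ, mul_pow, neg_sq]
  refine mul_le_mul_of_nonneg_right ?_ (sq_nonneg _)
  rcases eq_or_ne (eigenvalue α β κ) 0 with h | h
  · simp [h]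
  · nlinarith [one_le_eigenvalue hα hβ h]

/-- The Mellin transform of `Q_t f` is determined by its Jacobi coefficients. -/
theorem mellin_poissonQ (hα : ∀ i, -(1 / 2 : ℝ) < α i) (hβ : ∀ i, -(1 / 2 : ℝ) < β i)
    {f : (Fin d → ℝ) → ℝ} (hf : ContDiffOn ℝ 2 f (Icc (-1) 1)) {σ : ℝ} (hσ : -1 < σ)
    {g : (Fin d → ℝ) → ℝ} (hg : Integrable g (jacobiMeasure α β))
    (hgc : ∀ κ, jacobiCoeff α β g κ = if eigenvalue α β κ = 0 then 0 else
      eigenvalue α β κ ^ (-σ / 2) * jacobiCoeff α β f κ) :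
    ∀ᵐ x ∂jacobiMeasure α β,
      IntegrableOn (fun t => t ^ (σ - 1) * poissonQ α β t f x) (Ioi (0 : ℝ)) ∧
      Real.Gamma (σ + 1) * g x = ∫ t in Ioi (0 : ℝ), t ^ (σ - 1) * poissonQ α β t f x := by
  have := isFiniteMeasure_jacobiMeasure hα hβ
  have hf2 := memLp_jacobiMeasure_of_continuousOn hα hβ hf.continuousOn 2
  obtain ⟨h1, h2, h3⟩ := mellin_poissonQSeries (μ := jacobiMeasure α β) (e := jacobiPoly α β)
    (fun κ => memLp_jacobiMeasure_of_continuousOn hα hβ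
      (continuous_jacobiPoly α β κ).continuousOn 2) (integral_jacobiPoly_mul hα hβ)
    (fun κ => by
      obtain ⟨C, hC⟩ := isCompact_Icc.exists_bound_of_continuousOn
        ((continuous_jacobiPoly α β κ).continuousOn (s := Icc (-1) 1))
      exact ⟨C, (ae_mem_Icc_jacobiMeasure hα hβ).mono hC⟩)
    sqrtEigenvalue_nonneg (one_le_sqrtEigenvalue hα hβ) (abs_jacobiCoeff_le hα hβ hf2)
    (summable_eigenvalue_mul_jacobiCoeff_sq hα hβ hf)
    (fun t ht => summable_exp_sqrtEigenvalue hα hβ ht) hσ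
  have hae := ae_eq_of_jacobiCoeff_eq hα hβ (hg.const_mul (Real.Gamma (σ + 1))) h2 fun κ => by
    refine Eq.trans ?_ (h3 κ).symm
    rw [jacobiCoeff_const_mul, hgc]
    simp only [sqrtEigenvalue_eq_zero_iff hα hβ, sqrtEigenvalue_rpow hα hβ]
    split_ifs <;> simp
  filter_upwards [h1, hae, ae_summable_jacobiPoly hα hβ] with x hx1 hx2 hx3
  have e : ∀ t ∈ Ioi (0 : ℝ), t ^ (σ - 1) * poissonQSeries (jacobiPoly α β)
      (sqrtEigenvalue α β) (jacobiCoeff α β f) t x = t ^ (σ - 1) * poissonQ α β t f x :=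
    fun t ht => by rw [poissonQ_eq hα hβ hf2 hx3 ht]
  exact ⟨hx1.congr_fun e measurableSet_Ioi, hx2.trans (setIntegral_congr_fun measurableSet_Ioi e)⟩

theorem IsFracDeriv.integrable (hα : ∀ i, -(1 / 2 : ℝ) < α i) (hβ : ∀ i, -(1 / 2 : ℝ) < β i)
    {γ : ℝ} {f g : (Fin d → ℝ) → ℝ} (h : IsFracDeriv α β γ f g) :
    Integrable g (jacobiMeasure α β) := by
  have := isFiniteMeasure_jacobiMeasure hα hβ
  obtain ⟨p, hp, -, q, -, hg⟩ := h
  exact hg.1.integrable hp.le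

/-- Coefficients pass to `L^p` limits for every `p ≥ 1`. Those of `g` are thus fixed by `f` and `γ`
alone, which gives independence of `p` and of the sequence. -/
theorem IsFracDeriv.jacobiCoeff_eq (hα : ∀ i, -(1 / 2 : ℝ) < α i)
    (hβ : ∀ i, -(1 / 2 : ℝ) < β i) {γ : ℝ} {f g : (Fin d → ℝ) → ℝ} (h : IsFracDeriv α β γ f g)
    (κ : Fin d → ℕ) : jacobiCoeff α β g κ = eigenvalue α β κ ^ (γ / 2) * jacobiCoeff α β f κ := by
  obtain ⟨p, hp, -, q, ⟨-, hf⟩, hg⟩ := h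
  have h1 := hf.tendsto_jacobiCoeff hα hβ hp.le (fun n => MvPolynomial.continuous_eval _) κ
  have h2 := hg.tendsto_jacobiCoeff hα hβ hp.le (fun n => continuous_spectralOp hα hβ _ _) κ
  simp only [jacobiCoeff_spectralOp hα hβ] at h2
  exact tendsto_nhds_unique h2 (h1.const_mul _)

theorem IsFracInt.integrable (hα : ∀ i, -(1 / 2 : ℝ) < α i) (hβ : ∀ i, -(1 / 2 : ℝ) < β i)
    {γ : ℝ} {f g : (Fin d → ℝ) → ℝ} (h : IsFracInt α β γ f g) :
    Integrable g (jacobiMeasure α β) := by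
  have := isFiniteMeasure_jacobiMeasure hα hβ
  obtain ⟨p, hp, -, q, -, hg⟩ := h
  exact hg.1.integrable hp.le

theorem IsFracInt.jacobiCoeff_eq (hα : ∀ i, -(1 / 2 : ℝ) < α i)
    (hβ : ∀ i, -(1 / 2 : ℝ) < β i) {γ : ℝ} {f g : (Fin d → ℝ) → ℝ} (h : IsFracInt α β γ f g)
    (κ : Fin d → ℕ) : jacobiCoeff α β g κ =
      (if eigenvalue α β κ = 0 then 0 else 1 / eigenvalue α β κ ^ (γ / 2)) *
        jacobiCoeff α β f κ := by
  obtain ⟨p, hp, -, q, hf, hg⟩ := h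
  have h1 := hf.tendsto_jacobiCoeff hα hβ hp.le (fun n => MvPolynomial.continuous_eval _) κ
  have h2 := hg.tendsto_jacobiCoeff hα hβ hp.le (fun n => continuous_spectralOp hα hβ _ _) κ
  simp only [jacobiCoeff_spectralOp hα hβ] at h2
  exact tendsto_nhds_unique h2 (h1.const_mul _)

/-- It is enough to take `p = 2`: since `γ < 1`, `(1 + λ)^γ ≤ 1 + λ`, and `∑ (1 + λ) f̂²` converges.
-/
theorem exists_isFracDeriv (hα : ∀ i, -(1 / 2 : ℝ) < α i) (hβ : ∀ i, -(1 / 2 : ℝ) < β i)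
    {f : (Fin d → ℝ) → ℝ} (hf : ContDiffOn ℝ 2 f (Icc (-1) 1)) {γ : ℝ} (h0 : 0 < γ) (h1 : γ < 1) :
    ∃ g, IsFracDeriv α β γ f g := by
  obtain ⟨S, hS⟩ := exists_seq_tendsto (atTop : Filter (Finset (Fin d → ℕ)))
  have hf2 := memLp_jacobiMeasure_of_continuousOn hα hβ hf.continuousOn 2
  have hpow : ∀ {y : ℝ}, 0 ≤ y → (y ^ (γ / 2)) ^ 2 = y ^ γ := fun hy => by
    rw [← Real.rpow_natCast, ← Real.rpow_mul hy]
    congr 1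
    push_cast
    ring
  have hs : Summable fun κ =>
      ((1 + eigenvalue α β κ) ^ (γ / 2) * jacobiCoeff α β f κ) ^ 2 := by
    refine Summable.of_nonneg_of_le (fun κ => sq_nonneg _) (fun κ => ?_)
      ((summable_jacobiCoeff_sq hα hβ hf2).add (summable_eigenvalue_mul_jacobiCoeff_sq hα hβ hf))
    have hl := eigenvalue_nonneg hα hβ κ
    rw [mul_pow, mul_pow, sqrtEigenvalue_sq hα hβ, hpow (by positivity), ← one_add_mul]
    refine mul_le_mul_of_nonneg_right ?_ (sq_nonneg _)
    exact Real.rpow_le_self_of_one_le (by linarith) h1.le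
  have hs' : Summable fun κ => (eigenvalue α β κ ^ (γ / 2) * jacobiCoeff α β f κ) ^ 2 := by
    refine Summable.of_nonneg_of_le (fun κ => sq_nonneg _) (fun κ => ?_) hs
    have hl := eigenvalue_nonneg hα hβ κ
    rw [mul_pow, mul_pow, hpow hl, hpow (by positivity)]
    exact mul_le_mul_of_nonneg_right (Real.rpow_le_rpow hl (by linarith) h0.le) (sq_nonneg _)
  obtain ⟨g, hg⟩ := exists_tendstoLp_spectralOp hα hβ (fun r => r ^ (γ / 2)) hs' hS
  exact ⟨g, 2, by norm_num, by norm_num, _, tendstoSobolev_partialSum hα hβ hf2 hs hS, hg⟩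

/-- By the spectral gap the multiplier is at most `1`, so `p = 2` works for any `f` in `L²`. -/
theorem exists_isFracInt (hα : ∀ i, -(1 / 2 : ℝ) < α i) (hβ : ∀ i, -(1 / 2 : ℝ) < β i)
    {f : (Fin d → ℝ) → ℝ} (hf : MemLp f 2 (jacobiMeasure α β)) {γ : ℝ} (h0 : 0 < γ) :
    ∃ g, IsFracInt α β γ f g := by
  obtain ⟨S, hS⟩ := exists_seq_tendsto (atTop : Filter (Finset (Fin d → ℕ)))
  have hs : Summable fun κ => ((if eigenvalue α β κ = 0 then 0 else
      1 / eigenvalue α β κ ^ (γ / 2)) * jacobiCoeff α β f κ) ^ 2 := by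
    refine Summable.of_nonneg_of_le (fun κ => sq_nonneg _) (fun κ => ?_)
      (summable_jacobiCoeff_sq hα hβ hf)
    rw [mul_pow]
    refine mul_le_of_le_one_left (sq_nonneg _) ?_
    split_ifs with h
    · norm_num
    · have h1 := Real.one_le_rpow (one_le_eigenvalue hα hβ h) (by positivity : 0 ≤ γ / 2)
      exact pow_le_one₀ (by positivity) (div_le_one_of_le₀ h1 (by positivity))
  obtain ⟨g, hg⟩ := exists_tendstoLp_spectralOp hα hβ
    (fun r => if r = 0 then 0 else 1 / r ^ (γ / 2)) hs hS
  exact ⟨g, 2, by norm_num, by norm_num, _, tendstoLp_partialSum hα hβ hf hS, hg⟩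

end Poisson

end JacobiExpansion

end

/-! ### The integral representations of `D_γ f` and `I_γ f`. -/

theorem mainTheorem8 {d : ℕ} (α β : Fin d → ℝ)
    (hα : ∀ i, -(1 / 2 : ℝ) < α i) (hβ : ∀ i, -(1 / 2 : ℝ) < β i)
    (f : (Fin d → ℝ) → ℝ) (hf : ContDiffOn ℝ 2 f (Set.Icc (-1) 1))
    (hmean : ∫ y, f y ∂JacobiExpansion.jacobiMeasure α β = 0) :
    (∀ᵐ x ∂JacobiExpansion.jacobiMeasure α β, ∀ t : ℝ, 0 < t →
      DifferentiableAt ℝ (fun s => JacobiExpansion.poissonJacobi α β s f x) t) ∧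
    (∀ γ : ℝ, 0 < γ → γ < 1 →
      (∃ g, JacobiExpansion.IsFracDeriv α β γ f g) ∧
      ∀ g, JacobiExpansion.IsFracDeriv α β γ f g →
        ∀ᵐ x ∂JacobiExpansion.jacobiMeasure α β,
          MeasureTheory.IntegrableOn
            (fun t => t ^ (-γ - 1) * JacobiExpansion.poissonQ α β t f x) (Set.Ioi (0 : ℝ)) ∧
          -γ * g x = 1 / JacobiExpansion.cConst γ *
            ∫ t in Set.Ioi (0 : ℝ), t ^ (-γ - 1) * JacobiExpansion.poissonQ α β t f x) ∧
    (∀ γ : ℝ, 0 < γ →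
      (∃ g, JacobiExpansion.IsFracInt α β γ f g) ∧
      ∀ g, JacobiExpansion.IsFracInt α β γ f g →
        ∀ᵐ x ∂JacobiExpansion.jacobiMeasure α β,
          MeasureTheory.IntegrableOn
            (fun t => t ^ (γ - 1) * JacobiExpansion.poissonQ α β t f x) (Set.Ioi (0 : ℝ)) ∧
          γ * g x = 1 / Real.Gamma γ *
            ∫ t in Set.Ioi (0 : ℝ), t ^ (γ - 1) * JacobiExpansion.poissonQ α β t f x) := by
  have := JacobiExpansion.isFiniteMeasure_jacobiMeasure hα hβ
  have hf2 := JacobiExpansion.memLp_jacobiMeasure_of_continuousOn hα hβ hf.continuousOn 2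
  refine ⟨?_, fun γ h0 h1 => ⟨JacobiExpansion.exists_isFracDeriv hα hβ hf h0 h1, fun g hg => ?_⟩,
    fun γ h0 => ⟨JacobiExpansion.exists_isFracInt hα hβ hf2 h0, fun g hg => ?_⟩⟩
  · filter_upwards [JacobiExpansion.ae_summable_jacobiPoly hα hβ] with x hx t ht
    exact (JacobiExpansion.hasDerivAt_poissonJacobi hα hβ hf2 hx ht).differentiableAt
  -- The Mellin exponent `-γ` is admissible exactly because `γ < 1`. At `λ = 0` the multiplier
  -- `0^(γ/2)` vanishes, as the Mellin side requires.
  · have key := JacobiExpansion.mellin_poissonQ hα hβ hf (σ := -γ) (by linarith)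
      (hg.integrable hα hβ) fun κ => by
        rw [hg.jacobiCoeff_eq hα hβ, neg_neg]
        split_ifs with h
        · rw [h, Real.zero_rpow (by positivity), zero_mul]
        · rfl
    filter_upwards [key] with x hx
    refine ⟨hx.1, ?_⟩
    rw [← hx.2, JacobiExpansion.cConst_eq h0 h1, show -γ + 1 = 1 - γ by ring]
    have hG : Real.Gamma (1 - γ) ≠ 0 := (Real.Gamma_pos_of_pos (by linarith)).ne'
    field_simp
  -- The Mellin exponent `γ`; the component with `λ = 0` is removed by the definition of `I_γ` and
  -- absent from `Q_t f`.
  · have key := JacobiExpansion.mellin_poissonQ hα hβ hf (σ := γ) (by linarith)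
      (hg.integrable hα hβ) fun κ => by
        rw [hg.jacobiCoeff_eq hα hβ]
        split_ifs with h
        · rw [zero_mul]
        · rw [neg_div, Real.rpow_neg (JacobiExpansion.eigenvalue_nonneg hα hβ κ), one_div]
    filter_upwards [key] with x hx
    refine ⟨hx.1, ?_⟩
    rw [← hx.2, Real.Gamma_add_one h0.ne']
    have hG : Real.Gamma γ ≠ 0 := (Real.Gamma_pos_of_pos h0).ne'
    field_simp
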